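/- **Setting.** Let $\Phi(X,\theta)\in\mathbb R^n$ be a fully connected feedforward network with $k$ hidden layers, $\Phi_0=v_0^\top X_a$, $\Phi_j=v_j^\top\phi_j(\Phi_{j-1})$ ($1\le j\le k$), $\Phi=\Phi_k$, where $X\in\mathbb R^{2n}$, $X_a=(X,1)$, $\theta=(\mathrm{vec}\,v_0,\dots,\mathrm{vec}\,v_k)\in\mathbb R^\rho$, each $\phi_j$ acts componentwise by smooth functions and has last component $1$; let $\Phi'=\partial\Phi/\partial\theta$ (note $\Phi(X,0)=0$). The plant is $\ddot x=f(X)+u$, $X=(x,\dot x)$, $f\in C^1$, and $x_d\in C^2$ is a reference with $\|x_d\|\le\overline{x_d}$, $\|\dot x_d\|\le\overline{\dot x_d}$, $\|\ddot x_d\|\le\overline{\ddot x_d}$ on $[t_0,\infty)$. Let $\Theta=\{P\le 0\}\ni 0$ be compact, $P$ convex and $C^1$ with $\min P<0$, $\epsilon>0$, $\Theta_\epsilon=\{P\le\epsilon\}$, $\bar\theta=\max_{\Theta}\|\theta\|$, $\theta^*\in\Theta$, and $\varepsilon(X)=f(X)-\Phi(X,\theta^*)$. Put $e=x-x_d$,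 $r=\dot e+\alpha_1e$, $\tilde\theta=\theta^*-\hat\theta$, $\zeta=(r,e,\tilde\theta)$ and $$u=\ddot x_d-\Phi(X,\hat\theta)-k_1r-e-\alpha_1\dot e,$$ $$\dot{\hat r}=\hat\Delta-\ddot x_d+\alpha_1\dot e+\alpha_2\tilde r,\qquad \dot{\hat\Delta}=\tilde r+k_\Delta\tilde\Delta+\dot u,\qquad \tilde r=r-\hat r,\ \tilde\Delta=\ddot x-\hat\Delta,\ z=(\tilde r,\tilde\Delta).$$ The gains $k_1,\alpha_1,\alpha_2,k_\Delta,\gamma_1,\gamma_2$ and the accuracy $\delta_\Delta$ are positive. Data $X_i=X(t_i)$, $u_i=u(t_i)$, $\hat\Delta_i=\hat\Delta(t_i)$ are recorded at times $t_1,\dots,t_N\ge t_\Delta$, where $\Lambda_1=\min\{k_\Delta,2\alpha_2\}$, $t_\Delta=t_0$ if $\|z(t_0)\|\le\delta_\Delta$, and otherwise $t_\Delta=t_0+\frac1{\Lambda_1}\ln\frac{k_\Delta\Lambda_1\|z(t_0)\|^2-\delta_f^2}{k_\Delta\Lambda_1\delta_\Delta^2-\delta_f^2}$. With sums over the data already recorded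 ($t_i\le t$), the second concurrent-learning law is $$\dot{\hat\theta}=\mathrm{proj}\Bigl(\Gamma\bigl(\Phi'^\top(X,\hat\theta)r-\gamma_2\hat\theta-\gamma_1\textstyle\sum_{i}\Phi'^\top(X_i,\hat\theta)(u_i-\hat\Delta_i+\Phi'(X_i,\hat\theta)\hat\theta)\bigr)\Bigr),\qquad \hat\theta(t_0)\in\Theta_\epsilon,$$ where $\mathrm{proj}(\tau)=\tau$ if $P(\hat\theta)\le0$ or $\nabla P(\hat\theta)^\top\tau\le 0$, and $\mathrm{proj}(\tau)=\tau-\min\{1,P(\hat\theta)/\epsilon\}\frac{\nabla P^\top\tau}{\nabla P^\top\Gamma\nabla P}\Gamma\nabla P$ otherwise. The symmetric gain $\Gamma$ starts with eigenvalues in $[\lambda_{\Gamma,\min},\lambda_{\Gamma,\max}]\subset(0,\infty)$, and $\frac{d}{dt}\Gamma^{-1}=-\beta\Gamma^{-1}+\gamma_1\sum_i\Phi'^\top(X_i,\hat\theta)\Phi'(X_i,\hat\theta)$ (with $\beta(t)\ge0$) while $\lambda_{\Gamma,\min}<\lambda_{\min}(\Gamma)$ and $\lambda_{\max}(\Gamma)<\lambda_{\Gamma,\max}$,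 and $\frac{d}{dt}\Gamma^{-1}=0$ otherwise. Solutions are understood in the sense of Carathéodory. **Constants.** For $\hat\theta=\theta^*-\tilde\theta\in\Theta_\epsilon$ let $R(X,\tilde\theta)=\Phi(X,\theta^*)-\Phi(X,\hat\theta)-\Phi'(X,\hat\theta)\tilde\theta$ and $R_0(X,\hat\theta)=\Phi(X,0)-\Phi(X,\hat\theta)+\Phi'(X,\hat\theta)\hat\theta$. Let $\rho_1,\rho_2,\rho_3,\rho_5:\mathbb R_{\ge0}\to\mathbb R_{\ge0}$ be strictly increasing functions such that, for all $\hat\theta\in\Theta_\epsilon$, $\|\Phi'(X,\hat\theta)\|\le\rho_1(\|X\|)$ and $\|\Phi'^\top(X,\hat\theta)(\varepsilon(X)-R_0(X,\hat\theta))\|\le\rho_5(\|X\|)$ for every $X$, and $\|R(X,\tilde\theta)\|\le\rho_2(\|\zeta\|)\|\zeta\|^2$, $\|\Phi'^\top(X_i,\hat\theta)R(X_i,\tilde\theta)\|\le\rho_3(\|\zeta_i\|)\|\zeta\|^2$ whenever $X$ and $X_i$ are the inputs $(e+x_d,\,r-\alpha_1e+\dot x_d)$ that belong to $\zeta$, respectively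 to $\zeta_i$, at some time $t\ge t_0$. For $\lambda_e\ge0$ and $\lambda_{3d}>0$ let $\lambda_3=\min\{k_1-1,\ \alpha_1,\ \frac{\gamma_1}2\lambda_e+\frac{\gamma_2}2-\frac{\gamma_1N\delta_\Delta}2-\gamma_1N\}$, let $\rho_\delta:\mathbb R_{\ge0}\to\mathbb R_{\ge0}$ be strictly increasing with $\rho_\delta(a)\ge\frac12\rho_2(a)^2a^2+\frac{\gamma_1}2\sum_{i=1}^N\rho_3(\|\zeta(t_i)\|)^2a^2$ for all $a\ge 0$, and let $\chi_4=\rho_\delta^{-1}(\lambda_3-\lambda_{3d})$, $\mathcal D_4=\{\|\zeta\|\le\chi_4\}$, $\Omega_4=\{\|X\|\le(\alpha_1+2)\chi_4+\overline{x_d}+\overline{\dot x_d}\}$, where $\theta^*$ minimizes $\int_{\Omega_4}(\|f(X)-\Phi(X,\theta)\|^2+\sigma\|\theta\|^2)\,dX$ over $\Theta$ for some $\sigma>0$, and $\|\varepsilon\|\le\bar\varepsilon$ on $\Omega_4$. Let $\delta_f>0$ bound $\|\frac{d}{dt}f(x,\dot x)\|$, computed along the closed loop, for all $t\ge t_0$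 and all $\zeta\in\mathcal D_4$. Finally let $\beta_1=\min\{\frac12,\frac1{2\lambda_{\Gamma,\max}}\}$, $\beta_2=\max\{\frac12,\frac1{2\lambda_{\Gamma,\min}}\}$, $$\iota_4=\tfrac12\bar\varepsilon^2+\tfrac{\gamma_1N\delta_\Delta}2\sum_{i=1}^N\rho_1(\|X_i\|)^2+\tfrac{\gamma_1}2\sum_{i=1}^N\rho_5(\|X_i\|)^2+\tfrac{\gamma_2}2\bar\theta^2,\qquad \mathcal H=\Bigl\{\zeta:\|\zeta\|<\sqrt{\tfrac{\beta_1}{\beta_2}\chi_4^2-\tfrac{\iota_4}{\lambda_{3d}}}\Bigr\}$$ ($\mathcal H$ is empty if the radicand is not positive). **Theorem.** Functions $\rho_1,\rho_2,\rho_3,\rho_5$ as above exist, and so does, for every radius $\chi$ in place of $\chi_4$, a bound $\delta_f$. For any choice of them, suppose $k_\Delta\Lambda_1>\delta_f^2/\delta_\Delta^2$ and $\lambda_{3d}>0$, and consider any solution of the closed loop on $[t_0,b)$, $t_0<b\le\infty$, with all recording times in $[t_0,b)$. Let $T\in[t_0,b)$ and $\lambda_e\ge0$ be such that $\lambda_{\min}\{\sum_{i:\,t_i\le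 t}\Phi'^\top(X_i,\hat\theta(t))\Phi'(X_i,\hat\theta(t))\}\ge\lambda_e$ for all $t\in[T,b)$ (for $T=t_0$, $\lambda_e=0$ this is no restriction). If $\zeta(t)\in\mathcal D_4$ for $t_0\le t<T$ (void if $T=t_0$) and $\zeta(T)\in\mathcal H$, then for all $t\in[T,b)$ $$\|\zeta(t)\|\le\sqrt{\tfrac{\beta_2}{\beta_1}\|\zeta(T)\|^2e^{-\frac{\lambda_{3d}}{\beta_2}(t-T)}+\tfrac{\beta_2\iota_4}{\beta_1\lambda_{3d}}\Bigl(1-e^{-\frac{\lambda_{3d}}{\beta_2}(t-T)}\Bigr)}.$$ Moreover $\zeta(t)\in\mathcal D_4$, $X(t)\in\Omega_4$ and $\hat\theta(t)\in\Theta_\epsilon$ for all $t\in[t_0,b)$, and the signals $e,r,\tilde\theta,x,\dot x,\hat\theta,u,z,\hat r,\hat\Delta,\Gamma,\Gamma^{-1}$ are bounded on $[t_0,b)$. -/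

import Mathlib

open MeasureTheory
open scoped ContDiff

noncomputable section

namespace CLDNN

/-! ### The feedforward network -/

/-- Architecture of a fully connected network with `k` hidden layers: layer `j` has `L j` nodes
(bias node included), the output lives in `ℝⁿ` with `n = L (k + 1)`, and the input is a vector of
`ℝ²ⁿ` augmented by a `1`, so that `L 0 = 2 n + 1`. -/
structure Arch where
  k : ℕ
  L : ℕ → ℕ
  L_pos : ∀ j, j ≤ k + 1 → 0 < L j
  L_zero : L 0 = (L (k + 1) + L (k + 1)) + 1

namespace Arch

variable (A : Arch)

/-- Dimension of the generalized position. -/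
abbrev n : ℕ := A.L (A.k + 1)

/-- `ℝⁿ` with the Euclidean norm. -/
abbrev Vec : Type := EuclideanSpace ℝ (Fin A.n)

/-- `ℝ²ⁿ` with the Euclidean norm: the space of network inputs `X = (x, ẋ)`. -/
abbrev Inp : Type := EuclideanSpace ℝ (Fin (A.n + A.n))

/-- The indices of all the weights of `v₀, …, v_k`; there are `∑ L j * L (j + 1)` of them. -/
abbrev Idx : Type := (j : Fin (A.k + 1)) × (Fin (A.L j) × Fin (A.L (j + 1)))

/-- The space `ℝ^ρ` of weight vectors `θ = (vec v₀, …, vec v_k)`. -/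
abbrev Par : Type := EuclideanSpace ℝ A.Idx

/-- The space of error vectors `ζ = (r, e, θ̃)` with the Euclidean norm. -/
abbrev Err : Type := WithLp 2 (A.Vec × WithLp 2 (A.Vec × A.Par))

variable {A}

/-- Concatenation `(x, ẋ)`. -/
def pair (x v : A.Vec) : A.Inp := WithLp.toLp 2 (Fin.append x.ofLp v.ofLp)

/-- The error vector `(r, e, θ̃)`. -/
def err (r e : A.Vec) (w : A.Par) : A.Err := WithLp.toLp 2 (r, WithLp.toLp 2 (e, w))

/-- The weight matrix `v_j`, of size `L j × L (j + 1)` (only `j ≤ k` is ever used). -/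
def weight (θ : A.Par) (j : ℕ) : Matrix (Fin (A.L j)) (Fin (A.L (j + 1))) ℝ :=
  fun a b => if h : j < A.k + 1 then θ ⟨⟨j, h⟩, (a, b)⟩ else 0

/-- The augmented input `X_a = (X, 1)`. -/
def augment (X : A.Inp) : Fin (A.L 0) → ℝ :=
  fun i => if h : (i : ℕ) < A.n + A.n then X ⟨i, h⟩ else 1

/-- The activation vector `φ_j(y) = (ς_{j,1}(y₁), …, ς_{j,L_j - 1}(y_{L_j - 1}), 1)`. -/
def act (ς : ℕ → ℕ → ℝ → ℝ) (j : ℕ) (y : Fin (A.L j) → ℝ) : Fin (A.L j) → ℝ :=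
  fun i => if (i : ℕ) + 1 = A.L j then 1 else ς j i (y i)

/-- `Φ₀ = v₀ᵀ X_a` and `Φ_j = v_jᵀ φ_j(Φ_{j-1})`. -/
def layer (ς : ℕ → ℕ → ℝ → ℝ) (X : A.Inp) (θ : A.Par) : (j : ℕ) → Fin (A.L (j + 1)) → ℝ
  | 0 => Matrix.mulVec (Matrix.transpose (weight θ 0)) (augment X)
  | j + 1 => Matrix.mulVec (Matrix.transpose (weight θ (j + 1))) (act ς (j + 1) (layer ς X θ j))

end Arch

/-! ### Spectral bounds -/

/-- Smallest eigenvalue (of a self-adjoint operator). -/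
def lamMin {W : Type*} [NormedAddCommGroup W] [NormedSpace ℝ W] (B : W →L[ℝ] W) : ℝ :=
  sInf (spectrum ℝ B)

/-- Largest eigenvalue (of a self-adjoint operator). -/
def lamMax {W : Type*} [NormedAddCommGroup W] [NormedSpace ℝ W] (B : W →L[ℝ] W) : ℝ :=
  sSup (spectrum ℝ B)

/-! ### Smooth projection -/

open Classical in
/-- The smooth projection operator with adaptation gain `G` for the convex set `{P ≤ 0}` and the
boundary layer `{0 ≤ P ≤ ε}`: with `c(θ) = min {1, P(θ)/ε}`, it returns `τ` if `P(θ) ≤ 0` or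
`∇P(θ)ᵀ τ ≤ 0`, and `(I - c(θ) G ∇P ∇Pᵀ / (∇Pᵀ G ∇P)) τ` otherwise. -/
def proj {W : Type*} [NormedAddCommGroup W] [InnerProductSpace ℝ W] [CompleteSpace W]
    (P : W → ℝ) (ε : ℝ) (G : W →L[ℝ] W) (θ τ : W) : W :=
  if P θ ≤ 0 ∨ inner ℝ (gradient P θ) τ ≤ 0 then τ
  else τ - (min 1 (P θ / ε) *
    (inner ℝ (gradient P θ) τ / inner ℝ (gradient P θ) (G (gradient P θ)))) • G (gradient P θ)

/-! ### Plant, reference trajectory, parameter set and gains -/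

/-- The data of the tracking problem: network activations, plant `ẍ = f(x, ẋ) + u`, reference
trajectory, parameter search space `Θ = {P ≤ 0}`, ideal weights, and the gains of the controller,
of the observer and of the adaptation law. -/
structure Problem (A : Arch) where
  /-- activation functions `ς_{j,i}` -/
  ς : ℕ → ℕ → ℝ → ℝ
  ς_smooth : ∀ j i, 1 ≤ j → j ≤ A.k → ContDiff ℝ ∞ (ς j i)
  /-- the unknown drift -/
  f : A.Inp → A.Vec
  f_C1 : ContDiff ℝ 1 f
  /-- initial time -/
  t₀ : ℝ
  /-- reference trajectory and the bounds on it and its first two derivatives -/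
  xd : ℝ → A.Vec
  xd_C2 : ContDiff ℝ 2 xd
  xdB : ℝ
  xdB' : ℝ
  xdB'' : ℝ
  xd_le : ∀ t, t₀ ≤ t → ‖xd t‖ ≤ xdB
  xd'_le : ∀ t, t₀ ≤ t → ‖deriv xd t‖ ≤ xdB'
  xd''_le : ∀ t, t₀ ≤ t → ‖deriv (deriv xd) t‖ ≤ xdB''
  /-- defining function of the search space `{P ≤ 0}` and width of the boundary layer -/
  P : A.Par → ℝ
  P_convex : ConvexOn ℝ Set.univ P
  P_C1 : ContDiff ℝ 1 P
  P_compact : IsCompact {θ | P θ ≤ 0}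
  P_zero : P 0 ≤ 0
  P_slater : ∃ θ, P θ < 0
  εP : ℝ
  εP_pos : 0 < εP
  /-- ideal weights -/
  θs : A.Par
  θs_mem : P θs ≤ 0
  /-- controller gains -/
  k₁ : ℝ
  α₁ : ℝ
  k₁_pos : 0 < k₁
  α₁_pos : 0 < α₁
  /-- observer gains and prescribed observer accuracy -/
  α₂ : ℝ
  kΔ : ℝ
  δΔ : ℝ
  α₂_pos : 0 < α₂
  kΔ_pos : 0 < kΔ
  δΔ_pos : 0 < δΔ
  /-- adaptation gains, forgetting factor and eigenvalue thresholds of the gain matrix -/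
  γ₁ : ℝ
  γ₂ : ℝ
  γ₁_pos : 0 < γ₁
  γ₂_pos : 0 < γ₂
  β : ℝ → ℝ
  β_nonneg : ∀ t, 0 ≤ β t
  lΓmin : ℝ
  lΓmax : ℝ
  lΓmin_pos : 0 < lΓmin
  lΓ_le : lΓmin ≤ lΓmax

namespace Problem

variable {A : Arch} (p : Problem A)

/-- The network `Φ(X, θ) = Φ_k`. -/
def Φ (X : A.Inp) (θ : A.Par) : A.Vec := WithLp.toLp 2 (Arch.layer p.ς X θ A.k)

/-- The Jacobian `Φ'(X, θ) = ∂Φ/∂θ`. -/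
def J (X : A.Inp) (θ : A.Par) : A.Par →L[ℝ] A.Vec := fderiv ℝ (fun w => p.Φ X w) θ

/-- The transpose `Φ'ᵀ(X, θ)`. -/
def JT (X : A.Inp) (θ : A.Par) : A.Vec →L[ℝ] A.Par := ContinuousLinearMap.adjoint (p.J X θ)

/-- Remainder of the first-order Taylor expansion of `Φ(X, ·)` about `θ`, evaluated at `w`. -/
def rem (X : A.Inp) (θ w : A.Par) : A.Vec := p.Φ X w - p.Φ X θ - p.J X θ (w - θ)

/-- The function approximation error `ε(X) = f(X) - Φ(X, θ*)`. -/
def appErr (X : A.Inp) : A.Vec := p.f X - p.Φ X p.θs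

/-- The search space `Θ`. -/
def Θ : Set A.Par := {θ | p.P θ ≤ 0}

/-- The set `{P ≤ ε}`, i.e. `Θ` together with the boundary layer of the projection. -/
def Θε : Set A.Par := {θ | p.P θ ≤ p.εP}

/-- `θ̄ = max {‖θ‖ : θ ∈ Θ}`. -/
def θB : ℝ := sSup ((fun θ : A.Par => ‖θ‖) '' p.Θ)

/-- The regularized loss over the compact set `Ω`. -/
def loss (σ : ℝ) (Ω : Set A.Inp) (θ : A.Par) : ℝ :=
  ∫ X in Ω, (‖p.f X - p.Φ X θ‖ ^ 2 + σ * ‖θ‖ ^ 2)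

/-- `{ζ : ‖ζ‖ ≤ χ}`. -/
def D (_p : Problem A) (χ : ℝ) : Set A.Err := {z | ‖z‖ ≤ χ}

/-- The compact set of network inputs that contains `X` whenever `ζ ∈ D χ`. -/
def Ω (χ : ℝ) : Set A.Inp := {X | ‖X‖ ≤ (p.α₁ + 2) * χ + p.xdB + p.xdB'}

/-- The input `X = (x, ẋ)` as a function of time and of the errors:
`x = e + x_d`, `ẋ = r - α₁ e + ẋ_d`. -/
def inputOf (t : ℝ) (r e : A.Vec) : A.Inp :=
  Arch.pair (e + p.xd t) (r - p.α₁ • e + deriv p.xd t)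

/-- The control law as a function of time, of the errors and of the weight estimate:
`u = ẍ_d - Φ(X, θ̂) - k₁ r - e - α₁ ė` with `ė = r - α₁ e`. -/
def ctrl (t : ℝ) (r e : A.Vec) (θh : A.Par) : A.Vec :=
  deriv (deriv p.xd) t - p.Φ (p.inputOf t r e) θh - p.k₁ • r - e - p.α₁ • (r - p.α₁ • e)

/-- `δf` bounds `d/dt f(x, ẋ) = (∂f/∂x) ẋ + (∂f/∂ẋ) ẍ`, with `ẍ` given by the closed loop, for all
errors in `D χ`. -/
def IsFdotBound (χ δf : ℝ) : Prop :=
  ∀ t, p.t₀ ≤ t → ∀ (r e : A.Vec) (w : A.Par), Arch.err r e w ∈ p.D χ →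
    ‖fderiv ℝ p.f (p.inputOf t r e)
      (Arch.pair (r - p.α₁ • e + deriv p.xd t)
        (p.f (p.inputOf t r e) + p.ctrl t r e (p.θs - w)))‖ ≤ δf

/-- A strictly increasing function `ℝ≥0 → ℝ≥0`. -/
def IncrNonneg (ρ : ℝ → ℝ) : Prop :=
  StrictMonoOn ρ (Set.Ici 0) ∧ ∀ s, 0 ≤ s → 0 ≤ ρ s

/-- `ρ₁, ρ₂, ρ₃, ρ₅` are bounding functions for the Jacobian, for the Lagrange remainder
`R(X, θ̃) = Φ(X, θ*) - Φ(X, θ̂) - Φ'(X, θ̂) θ̃` along the current errors, for the same remainder at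
a recorded input premultiplied by the transposed Jacobian, and for the approximation error minus
the remainder of the expansion towards zero weights. Here `θ̂ = θ* - θ̃` ranges over the set in
which the projection keeps it. -/
structure IsBounding (ρ₁ ρ₂ ρ₃ ρ₅ : ℝ → ℝ) : Prop where
  incr₁ : IncrNonneg ρ₁
  incr₂ : IncrNonneg ρ₂
  incr₃ : IncrNonneg ρ₃
  incr₅ : IncrNonneg ρ₅
  jac : ∀ X, ∀ θ ∈ p.Θε, ‖p.J X θ‖ ≤ ρ₁ ‖X‖
  cur : ∀ t, p.t₀ ≤ t → ∀ (r e : A.Vec) (w : A.Par), p.θs - w ∈ p.Θε →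
    ‖p.rem (p.inputOf t r e) (p.θs - w) p.θs‖ ≤ ρ₂ ‖Arch.err r e w‖ * ‖Arch.err r e w‖ ^ 2
  hist : ∀ t, p.t₀ ≤ t → ∀ (ri ei : A.Vec) (wi : A.Par) (r e : A.Vec) (w : A.Par),
    p.θs - w ∈ p.Θε →
    ‖p.JT (p.inputOf t ri ei) (p.θs - w) (p.rem (p.inputOf t ri ei) (p.θs - w) p.θs)‖
      ≤ ρ₃ ‖Arch.err ri ei wi‖ * ‖Arch.err r e w‖ ^ 2
  zero : ∀ X, ∀ θ ∈ p.Θε, ‖p.JT X θ (p.appErr X - p.rem X θ 0)‖ ≤ ρ₅ ‖X‖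

/-- `Λ₁ = min {k_Δ, 2 α₂}`. -/
def Λ₁ : ℝ := min p.kΔ (2 * p.α₂)

/-- `β₁ = min {1/2, 1/(2 λ_{Γ,max})}`. -/
def β₁ : ℝ := min (1 / 2) (1 / 2 * (1 / p.lΓmax))

/-- `β₂ = max {1/2, 1/(2 λ_{Γ,min})}`. -/
def β₂ : ℝ := max (1 / 2) (1 / 2 * (1 / p.lΓmin))

/-- The constant `λ₃` for a history stack of size `N` with excitation level `lam_e`. -/
def lam₃ (N : ℕ) (lam_e : ℝ) : ℝ :=
  min (p.k₁ - 1) (min p.α₁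
    (p.γ₁ / 2 * lam_e + p.γ₂ / 2 - p.γ₁ * N * p.δΔ / 2 - p.γ₁ * N))

end Problem

/-! ### The closed loop -/

/-- The signals of the closed loop: position, velocity, weight estimate, least-squares gain `Γ` and
its inverse, observer states, and the recording times of the history stack. -/
structure Signals (A : Arch) (N : ℕ) where
  x : ℝ → A.Vec
  v : ℝ → A.Vec
  θh : ℝ → A.Par
  Γ : ℝ → A.Par →L[ℝ] A.Par
  Γinv : ℝ → A.Par →L[ℝ] A.Par
  rh : ℝ → A.Vec
  Δh : ℝ → A.Vec
  ts : Fin N → ℝ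

namespace Signals

variable {A : Arch} {N : ℕ} (s : Signals A N) (p : Problem A)

/-- `X = (x, ẋ)`. -/
def X (t : ℝ) : A.Inp := Arch.pair (s.x t) (s.v t)

/-- Tracking error `e = x - x_d`. -/
def e (t : ℝ) : A.Vec := s.x t - p.xd t

/-- `ė = ẋ - ẋ_d`. -/
def edot (t : ℝ) : A.Vec := s.v t - deriv p.xd t

/-- Filtered error `r = ė + α₁ e`. -/
def r (t : ℝ) : A.Vec := s.edot p t + p.α₁ • s.e p t

/-- Control input `u = ẍ_d - Φ(X, θ̂) - k₁ r - e - α₁ ė`. -/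
def u (t : ℝ) : A.Vec :=
  deriv (deriv p.xd) t - p.Φ (s.X t) (s.θh t) - p.k₁ • s.r p t - s.e p t - p.α₁ • s.edot p t

/-- Acceleration `ẍ = f(x, ẋ) + u`. -/
def acc (t : ℝ) : A.Vec := p.f (s.X t) + s.u p t

/-- Parameter estimation error `θ̃ = θ* - θ̂`. -/
def θt (t : ℝ) : A.Par := p.θs - s.θh t

/-- `ζ = (r, e, θ̃)`. -/
def ζ (t : ℝ) : A.Err := Arch.err (s.r p t) (s.e p t) (s.θt p t)

/-- Observer error `r̃ = r - r̂`. -/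
def rt (t : ℝ) : A.Vec := s.r p t - s.rh t

/-- Observer error `Δ̃ = ẍ - Δ̂`. -/
def Δt (t : ℝ) : A.Vec := s.acc p t - s.Δh t

/-- `z = (r̃, Δ̃)`. -/
def z (t : ℝ) : WithLp 2 (A.Vec × A.Vec) := WithLp.toLp 2 (s.rt p t, s.Δt p t)

/-- The data points recorded up to time `t`. -/
def stack (t : ℝ) : Finset (Fin N) := Finset.univ.filter (fun i => s.ts i ≤ t)

/-- `∑ Φ'ᵀ(X_i, θ̂) Φ'(X_i, θ̂)` over the data recorded up to time `t`, with `X_i = X(t_i)` and the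
current estimate `θ̂ = θ̂(t)`. -/
def gram (t : ℝ) : A.Par →L[ℝ] A.Par :=
  ∑ i ∈ s.stack t, (p.JT (s.X (s.ts i)) (s.θh t)).comp (p.J (s.X (s.ts i)) (s.θh t))

/-- The unprojected second concurrent-learning law
`Γ (Φ'ᵀ(X, θ̂) r - γ₂ θ̂ - γ₁ ∑ Φ'ᵀ(X_i, θ̂) (u_i - Δ̂_i + Φ'(X_i, θ̂) θ̂))`. -/
def rawLaw (t : ℝ) : A.Par :=
  s.Γ t (p.JT (s.X t) (s.θh t) (s.r p t) - p.γ₂ • s.θh t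
    - p.γ₁ • ∑ i ∈ s.stack t, p.JT (s.X (s.ts i)) (s.θh t)
        (s.u p (s.ts i) - s.Δh (s.ts i) + p.J (s.X (s.ts i)) (s.θh t) (s.θh t)))

/-- Right-hand side of the weight update law. -/
def θrhs (t : ℝ) : A.Par := proj p.P p.εP (s.Γ t) (s.θh t) (s.rawLaw p t)

open Classical in
/-- Right-hand side of the differential equation for `Γ⁻¹`. -/
def Γrhs (t : ℝ) : A.Par →L[ℝ] A.Par :=
  if p.lΓmin < lamMin (s.Γ t) ∧ lamMax (s.Γ t) < p.lΓmax then
    -(p.β t • s.Γinv t) + p.γ₁ • s.gram p t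
  else 0

open Classical in
/-- Settling time of the observer for the accuracy `δ_Δ`; it is the initial time if the observer
error has this accuracy from the start. -/
def tΔ (δf : ℝ) : ℝ :=
  if ‖s.z p p.t₀‖ ≤ p.δΔ then p.t₀
  else p.t₀ + 1 / p.Λ₁ * Real.log
    ((p.kΔ * p.Λ₁ * ‖s.z p p.t₀‖ ^ 2 - δf ^ 2) / (p.kΔ * p.Λ₁ * p.δΔ ^ 2 - δf ^ 2))

/-- The constant `ι₄`. -/
def ι₄ (ρ₁ ρ₅ : ℝ → ℝ) (εB : ℝ) : ℝ :=
  1 / 2 * εB ^ 2 + p.γ₁ * N * p.δΔ / 2 * ∑ i, ρ₁ ‖s.X (s.ts i)‖ ^ 2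
    + p.γ₁ / 2 * ∑ i, ρ₅ ‖s.X (s.ts i)‖ ^ 2 + p.γ₂ / 2 * p.θB ^ 2

/-- The set `ℋ` of stabilizing initial conditions, with `χ₄ = ρ_δ⁻¹(λ₃ - λ_{3d})`. -/
def H (ρ₁ ρ₅ : ℝ → ℝ) (εB χ₄ lam₃d : ℝ) : Set A.Err :=
  {σ | ‖σ‖ < √(p.β₁ / p.β₂ * χ₄ ^ 2 - s.ι₄ p ρ₁ ρ₅ εB / lam₃d)}

end Signals

/-- The interval `[t₀, b)`, with `b ≤ ∞`. -/
def span (t₀ : ℝ) (b : EReal) : Set ℝ := {t | t₀ ≤ t ∧ (t : EReal) < b}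

/-- `y` is a Carathéodory solution of `ẏ = g` on `[t₀, b)`. -/
def IsCaratheodory {W : Type*} [NormedAddCommGroup W] [NormedSpace ℝ W]
    (t₀ : ℝ) (b : EReal) (y g : ℝ → W) : Prop :=
  ∀ t ∈ span t₀ b, IntervalIntegrable g volume t₀ t ∧ y t = y t₀ + ∫ τ in t₀..t, g τ

/-- The signals form a solution on `[t₀, b)` of the closed loop made of the plant, the controller,
the state-derivative observer and the second concurrent-learning law, with data recorded only after
the settling time of the observer. -/
structure IsClosedLoop {A : Arch} {N : ℕ} (p : Problem A) (s : Signals A N) (b : EReal) (δf : ℝ) :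
    Prop where
  nonempty : (p.t₀ : EReal) < b
  pos : ∀ t ∈ span p.t₀ b, HasDerivWithinAt s.x (s.v t) (span p.t₀ b) t
  vel : ∀ t ∈ span p.t₀ b, HasDerivWithinAt s.v (p.f (s.X t) + s.u p t) (span p.t₀ b) t
  obs_r : ∀ t ∈ span p.t₀ b, HasDerivWithinAt s.rh
    (s.Δh t - deriv (deriv p.xd) t + p.α₁ • s.edot p t + p.α₂ • s.rt p t) (span p.t₀ b) t
  /-- the observer equation `d/dt Δ̂ = r̃ + k_Δ Δ̃ + d/dt u`, written without the derivative
  of `u` -/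
  obs_Δ : ∀ t ∈ span p.t₀ b, HasDerivWithinAt (fun τ => s.Δh τ - s.u p τ)
    (s.rt p t + p.kΔ • s.Δt p t) (span p.t₀ b) t
  θ_init : s.θh p.t₀ ∈ p.Θε
  θ_law : IsCaratheodory p.t₀ b s.θh (s.θrhs p)
  Γ_inv : ∀ t ∈ span p.t₀ b, (s.Γ t).comp (s.Γinv t) = ContinuousLinearMap.id ℝ A.Par ∧
    (s.Γinv t).comp (s.Γ t) = ContinuousLinearMap.id ℝ A.Par
  Γ_init : IsSelfAdjoint (s.Γ p.t₀) ∧ p.lΓmin ≤ lamMin (s.Γ p.t₀) ∧ lamMax (s.Γ p.t₀) ≤ p.lΓmax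
  Γ_law : IsCaratheodory p.t₀ b s.Γinv (s.Γrhs p)
  rec_mem : ∀ i, s.ts i ∈ span p.t₀ b
  rec_late : ∀ i, s.tΔ p δf ≤ s.ts i

end CLDNN

end

namespace CLDNN

open Set Filter Topology

/-! ### Absolutely continuous functions with an almost everywhere derivative -/

section AbsolutelyContinuous

variable {E F G : Type*} [NormedAddCommGroup E] [NormedSpace ℝ E] [NormedAddCommGroup F]
  [NormedSpace ℝ F] [NormedAddCommGroup G] [NormedSpace ℝ G]

/-! The Lyapunov function is V = ½‖r‖² + ½‖e‖² + ½ θ̃ᵀΓ⁻¹θ̃. It is comparable to ‖ζ‖² with constants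
β₁, β₂ (`lyap_bounds`), because Γ⁻¹ stays symmetric and between 1/λ_{Γ,max} and 1/λ_{Γ,min}
(`Γinv_symm`, `Γinv_bounds`).

By `data_eq`, each recorded term is -Φ'θ̃ plus observer error, approximation error and Taylor
remainders, so the data contribute -γ₁ times the Gram form of θ̃ to V'. The growth of Γ⁻¹ spends at
most half of it; the other half and the leakage γ₂ give decay in θ̃. The cross terms rᵀΦ'θ̃ and rᵀe
cancel, the projection can only help by convexity (`inner_inv_le_inner_inv_proj`), and the Taylor
remainders cost at most ρδ(‖ζ‖)‖ζ‖², which λ₃ - λ₃d pays for inside the ball of radius χ₄. Hence V'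
≤ -(λ₃d/β₂)V + ι₄ (`lyap_deriv_le`).

This needs ζ in the ball and an observer error at most δΔ at the recording times. The latter follows
from the former, since in the ball d/dt f is bounded and the observer error obeys its own decay
estimate (`norm_Δt_le`). The circle is closed by a first-exit argument: ℋ is sized so that the
envelope stays strictly below χ₄ (`envelope_lt`).

Carathéodory solutions are differentiable only almost everywhere, so the Lyapunov calculus is done
for absolutely continuous functions, with `HasACDeriv.le_exp_of_le` as comparison principle. The
existence claims are compactness: Θε is compact, and time enters only through the bounded reference.
-/

theorem absolutelyContinuousOnInterval_of_dist_le {X Y : Type*} [PseudoMetricSpace X]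
    [PseudoMetricSpace Y] {f : ℝ → X} {h : ℝ → Y} {a b K : ℝ}
    (hh : AbsolutelyContinuousOnInterval h a b)
    (hfh : ∀ x ∈ uIcc a b, ∀ y ∈ uIcc a b, dist (f x) (f y) ≤ K * dist (h x) (h y)) :
    AbsolutelyContinuousOnInterval f a b := by
  have h0 := Tendsto.const_mul K hh
  rw [mul_zero] at h0
  refine squeeze_zero' (Eventually.of_forall fun t => Finset.sum_nonneg fun i _ => dist_nonneg)
    ?_ h0
  have hmem : AbsolutelyContinuousOnInterval.disjWithin a b ∈
      (AbsolutelyContinuousOnInterval.totalLengthFilter (X := ℝ) ⊓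
        𝓟 (AbsolutelyContinuousOnInterval.disjWithin a b)) :=
    mem_inf_of_right (mem_principal_self _)
  filter_upwards [hmem] with t ht
  rw [Finset.mul_sum]
  exact Finset.sum_le_sum fun i hi => hfh _ (ht.1 i hi).1 _ (ht.1 i hi).2

/-- `y` is absolutely continuous on `[a, b]` with derivative `g` almost everywhere. -/
structure HasACDeriv (y g : ℝ → E) (a b : ℝ) : Prop where
  ac : AbsolutelyContinuousOnInterval y a b
  deriv : ∀ᵐ t, t ∈ Ioo a b → HasDerivAt y (g t) t

theorem HasACDeriv.continuousOn {y g : ℝ → E} {a b : ℝ} (hab : a ≤ b) (h : HasACDeriv y g a b) :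
    ContinuousOn y (Icc a b) := by
  simpa [uIcc_of_le hab] using h.ac.continuousOn

theorem HasACDeriv.mono {y g : ℝ → E} {a b c d : ℝ} (h : HasACDeriv y g a b) (hac : a ≤ c)
    (hcd : c ≤ d) (hdb : d ≤ b) : HasACDeriv y g c d := by
  refine ⟨h.ac.mono ?_, ?_⟩
  · rw [uIcc_of_le hcd, uIcc_of_le (hac.trans (hcd.trans hdb))]
    exact Icc_subset_Icc hac hdb
  · filter_upwards [h.deriv] with t ht htm
    exact ht (Ioo_subset_Ioo hac hdb htm)

theorem HasACDeriv.prodMk {y g : ℝ → E} {z k : ℝ → F} {a b : ℝ} (hy : HasACDeriv y g a b)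
    (hz : HasACDeriv z k a b) :
    HasACDeriv (fun t => (y t, z t)) (fun t => (g t, k t)) a b := by
  refine ⟨?_, ?_⟩
  · refine squeeze_zero (fun t => Finset.sum_nonneg fun i _ => dist_nonneg) (fun t => ?_)
      (by simpa using Tendsto.add hy.ac hz.ac)
    rw [← Finset.sum_add_distrib]
    refine Finset.sum_le_sum fun i _ => ?_
    rw [Prod.dist_eq]
    exact max_le_add_of_nonneg dist_nonneg dist_nonneg
  · filter_upwards [hy.deriv, hz.deriv] with t h1 h2 ht
    exact (h1 ht).prodMk (h2 ht)

/-- A C¹ map is Lipschitz on the compact image of the curve, and Lipschitz maps preserve absolute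
continuity. -/
theorem HasACDeriv.comp {y g : ℝ → E} {a b : ℝ} {φ : E → F} (hab : a ≤ b) (hφ : ContDiff ℝ 1 φ)
    (hy : HasACDeriv y g a b) :
    HasACDeriv (fun t => φ (y t)) (fun t => fderiv ℝ φ (y t) (g t)) a b := by
  refine ⟨?_, ?_⟩
  · have hc : IsCompact (y '' Icc a b) := isCompact_Icc.image_of_continuousOn (hy.continuousOn hab)
    obtain ⟨K, hK⟩ := (hφ.locallyLipschitz.locallyLipschitzOn
      (s := y '' Icc a b)).exists_lipschitzOnWith_of_compact hc
    refine absolutelyContinuousOnInterval_of_dist_le hy.ac (K := K) fun u hu v hv => ?_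
    rw [uIcc_of_le hab] at hu hv
    exact hK.dist_le_mul _ (mem_image_of_mem _ hu) _ (mem_image_of_mem _ hv)
  · filter_upwards [hy.deriv] with t h1 ht
    exact ((hφ.differentiable one_ne_zero).differentiableAt.hasFDerivAt).comp_hasDerivAt t (h1 ht)

theorem HasACDeriv.clm_comp {y g : ℝ → E} {a b : ℝ} (hab : a ≤ b) (φ : E →L[ℝ] F)
    (hy : HasACDeriv y g a b) : HasACDeriv (fun t => φ (y t)) (fun t => φ (g t)) a b := by
  simpa using hy.comp hab φ.contDiff

theorem HasACDeriv.eq_of_forall_eq_zero {y g : ℝ → E} {a b : ℝ} (hab : a ≤ b)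
    (hy : HasACDeriv y g a b) (hg : ∀ t ∈ Ioo a b, g t = 0) : y b = y a := by
  have h : ∀ᵐ t, t ∈ uIcc a b → HasDerivAt y 0 t := by
    have ha : ∀ᵐ t : ℝ, t ≠ a := by simp [ae_iff, measure_singleton]
    have hb : ∀ᵐ t : ℝ, t ≠ b := by simp [ae_iff, measure_singleton]
    filter_upwards [hy.deriv, ha, hb] with t h1 h2 h3 ht
    rw [uIcc_of_le hab] at ht
    have ht' : t ∈ Ioo a b := ⟨lt_of_le_of_ne ht.1 h2.symm, lt_of_le_of_ne ht.2 h3⟩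
    exact hg t ht' ▸ h1 ht'
  obtain ⟨C, hC⟩ := hy.ac.const_of_ae_hasDerivAt_zero h
  rw [hC a left_mem_uIcc, hC b right_mem_uIcc]

theorem HasACDeriv.congr_deriv {y g k : ℝ → E} {a b : ℝ} (hy : HasACDeriv y g a b)
    (h : ∀ t ∈ Ioo a b, g t = k t) : HasACDeriv y k a b := by
  refine ⟨hy.ac, ?_⟩
  filter_upwards [hy.deriv] with t h1 ht
  exact h t ht ▸ h1 ht

theorem HasACDeriv.add {y g z k : ℝ → E} {a b : ℝ} (hy : HasACDeriv y g a b)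
    (hz : HasACDeriv z k a b) : HasACDeriv (fun t => y t + z t) (fun t => g t + k t) a b := by
  refine ⟨hy.ac.fun_add hz.ac, ?_⟩
  filter_upwards [hy.deriv, hz.deriv] with t h1 h2 ht
  exact (h1 ht).add (h2 ht)

theorem HasACDeriv.sub {y g z k : ℝ → E} {a b : ℝ} (hy : HasACDeriv y g a b)
    (hz : HasACDeriv z k a b) : HasACDeriv (fun t => y t - z t) (fun t => g t - k t) a b := by
  refine ⟨hy.ac.fun_sub hz.ac, ?_⟩
  filter_upwards [hy.deriv, hz.deriv] with t h1 h2 ht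
  exact (h1 ht).sub (h2 ht)

theorem HasACDeriv.const_smul {y g : ℝ → E} {a b : ℝ} (c : ℝ) (hy : HasACDeriv y g a b) :
    HasACDeriv (fun t => c • y t) (fun t => c • g t) a b := by
  refine ⟨hy.ac.const_smul c, ?_⟩
  filter_upwards [hy.deriv] with t h1 ht
  exact (h1 ht).const_smul c

theorem HasACDeriv.const_sub {y g : ℝ → E} {a b : ℝ} (c : E) (hy : HasACDeriv y g a b) :
    HasACDeriv (fun t => c - y t) (fun t => -g t) a b := by
  refine ⟨absolutelyContinuousOnInterval_of_dist_le hy.ac (K := 1) fun u _ v _ => by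
    rw [one_mul, dist_sub_left], ?_⟩
  filter_upwards [hy.deriv] with t h1 ht
  exact (h1 ht).const_sub c

theorem HasACDeriv.clm_apply {L k : ℝ → E →L[ℝ] F} {y g : ℝ → E} {a b : ℝ} (hab : a ≤ b)
    (hL : HasACDeriv L k a b) (hy : HasACDeriv y g a b) :
    HasACDeriv (fun t => L t (y t)) (fun t => k t (y t) + L t (g t)) a b := by
  have hφ : ContDiff ℝ 1 (fun q : (E →L[ℝ] F) × E => q.1 q.2) :=
    isBoundedBilinearMap_apply.contDiff
  refine ⟨((hL.prodMk hy).comp hab hφ).ac, ?_⟩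
  filter_upwards [hL.deriv, hy.deriv] with t h1 h2 ht
  exact (h1 ht).clm_apply (h2 ht)

theorem HasACDeriv.inner {H : Type*} [NormedAddCommGroup H] [InnerProductSpace ℝ H]
    {y g z k : ℝ → H} {a b : ℝ} (hab : a ≤ b)
    (hy : HasACDeriv y g a b) (hz : HasACDeriv z k a b) :
    HasACDeriv (fun t => Inner.inner ℝ (y t) (z t))
      (fun t => Inner.inner ℝ (y t) (k t) + Inner.inner ℝ (g t) (z t)) a b := by
  have hφ : ContDiff ℝ 1 (fun q : H × H => Inner.inner ℝ q.1 q.2) := contDiff_inner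
  refine ⟨((hy.prodMk hz).comp hab hφ).ac, ?_⟩
  filter_upwards [hy.deriv, hz.deriv] with t h1 h2 ht
  exact (h1 ht).inner ℝ (h2 ht)

theorem hasACDeriv_of_contDiff {y : ℝ → E} (hy : ContDiff ℝ 1 y) (a b : ℝ) :
    HasACDeriv y (_root_.deriv y) a b :=
  ⟨hy.contDiffOn.absolutelyContinuousOnInterval,
    Eventually.of_forall fun _ _ => (hy.differentiable one_ne_zero).differentiableAt.hasDerivAt⟩

theorem hasACDeriv_of_hasDerivWithinAt {y g : ℝ → E} {a b : ℝ} (hab : a ≤ b)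
    (hy : ∀ t ∈ Icc a b, HasDerivWithinAt y (g t) (Icc a b) t) (hg : ContinuousOn g (Icc a b)) :
    HasACDeriv y g a b := by
  obtain ⟨C, hC⟩ := isCompact_Icc.exists_bound_of_continuousOn hg
  have hlip := (convex_Icc a b).lipschitzOnWith_of_nnnorm_hasDerivWithin_le (C := C.toNNReal) hy
    (fun t ht => by
      rw [← NNReal.coe_le_coe, coe_nnnorm]
      exact (hC t ht).trans (Real.le_coe_toNNReal C))
  refine ⟨LipschitzOnWith.absolutelyContinuousOnInterval (K := C.toNNReal)
    (by rwa [uIcc_of_le hab]), Eventually.of_forall fun t ht => ?_⟩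
  exact (hy t (Ioo_subset_Icc_self ht)).hasDerivAt (Icc_mem_nhds ht.1 ht.2)

/-- Absolute continuity makes the increment the integral of the derivative, so a sign of the
almost-everywhere derivative suffices. -/
theorem HasACDeriv.le_of_nonpos {v g : ℝ → ℝ} {a b : ℝ} (hab : a ≤ b) (hv : HasACDeriv v g a b)
    (hg : ∀ t ∈ Ioo a b, g t ≤ 0) : v b ≤ v a := by
  have h := hv.ac.integral_deriv_eq_sub
  have hle : ∫ t in a..b, _root_.deriv v t ≤ 0 := by
    rw [intervalIntegral.integral_of_le hab, integral_Ioc_eq_integral_Ioo]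
    refine setIntegral_nonpos_ae measurableSet_Ioo ?_
    filter_upwards [hv.deriv] with t h1 ht
    rw [(h1 ht).deriv]
    exact hg t ht
  linarith

/-- Comparison with the linear differential equation `v' = -c v + d`. -/
theorem HasACDeriv.le_exp_of_le {v g : ℝ → ℝ} {a b c d : ℝ} (hab : a ≤ b) (hc : 0 < c)
    (hv : HasACDeriv v g a b) (hg : ∀ t ∈ Ioo a b, g t ≤ -c * v t + d) :
    v b ≤ v a * Real.exp (-c * (b - a)) + d / c * (1 - Real.exp (-c * (b - a))) := by
  have he : HasACDeriv (fun t => Real.exp (c * (t - a))) (fun t => c * Real.exp (c * (t - a)))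
      a b := by
    refine (hasACDeriv_of_contDiff (y := fun t => Real.exp (c * (t - a))) (by fun_prop)
      a b).congr_deriv fun t _ => ?_
    have : HasDerivAt (fun t => Real.exp (c * (t - a))) (Real.exp (c * (t - a)) * (c * 1)) t :=
      (((hasDerivAt_id t).sub_const a).const_mul c).exp
    rw [this.deriv]; ring
  -- Integrating factor: exp(c(t - a)) (d/c - v) has derivative exp(c(t - a)) (d - c v - g) ≥ 0. It
  -- is negated below to apply the monotonicity lemma.
  have hw := he.inner hab (hv.const_sub (d / c))
  have hle := hw.const_smul (-1) |>.le_of_nonpos hab fun t ht => by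
    have h1 := hg t ht
    have h2 := Real.exp_pos (c * (t - a))
    have h3 : d / c * c = d := by field_simp
    simp only [smul_eq_mul, RCLike.inner_apply, conj_trivial]
    have : 0 ≤ Real.exp (c * (t - a)) * (-c * v t + d - g t) :=
      mul_nonneg h2.le (by linarith)
    nlinarith [h3]
  simp only [smul_eq_mul, RCLike.inner_apply, conj_trivial, sub_self, mul_zero,
    Real.exp_zero, mul_one] at hle
  have h4 : Real.exp (-c * (b - a)) * Real.exp (c * (b - a)) = 1 := by
    rw [← Real.exp_add]; simp
  have h5 := Real.exp_pos (-c * (b - a))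
  have h6 := mul_le_mul_of_nonneg_right hle h5.le
  have h7 : -1 * ((d / c - v b) * Real.exp (c * (b - a))) * Real.exp (-c * (b - a))
      = v b - d / c := by
    linear_combination (v b - d / c) * h4
  rw [h7] at h6
  linarith

/-- Grönwall's inequality in its right-slope form, with the negative rate `-c`. As `v` is
differentiable everywhere, no regularity of `g` is required; this version serves the observer error.
-/
theorem le_exp_of_hasDerivWithinAt_le {v g : ℝ → ℝ} {a b c d : ℝ} (hab : a ≤ b) (hc : 0 < c)
    (hv : ∀ t ∈ Icc a b, HasDerivWithinAt v (g t) (Icc a b) t)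
    (hg : ∀ t ∈ Icc a b, g t ≤ -c * v t + d) :
    v b ≤ v a * Real.exp (-c * (b - a)) + d / c * (1 - Real.exp (-c * (b - a))) := by
  have h := le_gronwallBound_of_liminf_deriv_right_le (f := v) (f' := g) (δ := v a) (K := -c)
    (ε := d) (a := a) (b := b) (fun t ht => (hv t ht).continuousWithinAt)
    (fun t ht r hr => by
      have h1 : HasDerivWithinAt v (g t) (Ici t) t :=
        (hv t (Ico_subset_Icc_self ht)).mono_of_mem_nhdsWithin
          (mem_of_superset (Icc_mem_nhdsGE ht.2) (Icc_subset_Icc_left ht.1))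
      exact h1.liminf_right_slope_le hr)
    le_rfl (fun t ht => hg t (Ico_subset_Icc_self ht)) b (right_mem_Icc.2 hab)
  rw [gronwallBound_of_K_ne_0 (neg_ne_zero.2 hc.ne')] at h
  refine h.trans (le_of_eq ?_)
  rw [div_neg]
  ring

/-- Increments of the integral of `g` are dominated by those of the integral of `‖g‖`, which reduces
the vector-valued case to the scalar one. -/
theorem absolutelyContinuousOnInterval_integral {g : ℝ → E} {a b : ℝ}
    (hg : IntervalIntegrable g volume a b) :
    AbsolutelyContinuousOnInterval (fun t => ∫ τ in a..t, g τ) a b := by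
  have hn := hg.norm.absolutelyContinuousOnInterval_intervalIntegral (c := a) left_mem_uIcc
  refine absolutelyContinuousOnInterval_of_dist_le hn (K := 1) fun u hu v hv => ?_
  have hi : ∀ w ∈ uIcc a b, IntervalIntegrable g volume a w := fun w hw =>
    hg.mono_set (uIcc_subset_uIcc left_mem_uIcc hw)
  rw [one_mul, dist_eq_norm, dist_eq_norm,
    intervalIntegral.integral_interval_sub_left (hi u hu) (hi v hv),
    intervalIntegral.integral_interval_sub_left (hi u hu).norm (hi v hv).norm]
  exact intervalIntegral.norm_integral_le_abs_integral_norm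

theorem IsCaratheodory.hasACDeriv [CompleteSpace E] {t₀ : ℝ} {b : EReal} {y g : ℝ → E}
    (h : IsCaratheodory t₀ b y g) {c : ℝ} (hc : c ∈ span t₀ b) : HasACDeriv y g t₀ c := by
  have hcongr : ∀ t ∈ Icc t₀ c, y t = y t₀ + ∫ τ in t₀..t, g τ := fun t ht =>
    (h t ⟨ht.1, lt_of_le_of_lt (EReal.coe_le_coe_iff.2 ht.2) hc.2⟩).2
  have hi := (h c hc).1
  refine ⟨absolutelyContinuousOnInterval_of_dist_le
    (absolutelyContinuousOnInterval_integral hi) (K := 1) fun u hu v hv => ?_, ?_⟩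
  · rw [uIcc_of_le hc.1] at hu hv
    rw [hcongr u hu, hcongr v hv]
    simp
  · filter_upwards [hi.ae_hasDerivAt_integral] with t ht htm
    have h1 := (ht (by rw [uIcc_of_le hc.1]; exact Ioo_subset_Icc_self htm) t₀
      left_mem_uIcc).const_add (y t₀)
    refine h1.congr_of_eventuallyEq ?_
    filter_upwards [Icc_mem_nhds htm.1 htm.2] with w hw using hcongr w hw

end AbsolutelyContinuous

/-- Last time at which a closed condition holds. -/
theorem exists_last_mem {S : Set ℝ} {a b : ℝ} (hS : IsClosed (S ∩ Icc a b)) (hab : a ≤ b)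
    (ha : a ∈ S) (hb : b ∉ S) : ∃ c ∈ S, a ≤ c ∧ c < b ∧ ∀ t, c < t → t ≤ b → t ∉ S := by
  have hne : (S ∩ Icc a b).Nonempty := ⟨a, ha, left_mem_Icc.2 hab⟩
  have hcomp : IsCompact (S ∩ Icc a b) := isCompact_Icc.of_isClosed_subset hS inter_subset_right
  obtain ⟨c, hc, hmax⟩ := hcomp.exists_isGreatest hne
  refine ⟨c, hc.1, hc.2.1, lt_of_le_of_ne hc.2.2 fun h => hb (h ▸ hc.1), fun t h1 h2 ht => ?_⟩
  exact absurd (hmax ⟨ht, hc.2.1.trans h1.le, h2⟩) (not_le.2 h1)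

/-! ### Quadratic forms of self-adjoint operators -/

section Operators

variable {W : Type*} [NormedAddCommGroup W] [InnerProductSpace ℝ W]

theorem mem_spectrum_of_apply_eq_smul {B : W →L[ℝ] W} {μ : ℝ} {x : W} (hx : x ≠ 0)
    (h : B x = μ • x) : μ ∈ spectrum ℝ B := by
  rw [spectrum.mem_iff]
  rintro ⟨U, hU⟩
  apply hx
  have h1 : (U : W →L[ℝ] W) x = 0 := by
    rw [hU, sub_apply, h, Algebra.algebraMap_eq_smul_one]
    simp
  have h2 : ((U⁻¹ : (W →L[ℝ] W)ˣ) : W →L[ℝ] W) ((U : W →L[ℝ] W) x) = x := by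
    rw [← mul_apply_eq_comp, Units.inv_mul, one_apply_eq_self]
  rw [← h2, h1, map_zero]

theorem inner_le_of_rayleighQuotient_le {B : W →L[ℝ] W} {x w : W} (hw : w ≠ 0) (hx : ‖x‖ = ‖w‖)
    (h : B.reApplyInnerSelf x ≤ B.reApplyInnerSelf w) :
    B.rayleighQuotient x * ‖w‖ ^ 2 ≤ inner ℝ (B w) w := by
  have hpos : (0 : ℝ) < ‖w‖ ^ 2 := by positivity
  rw [ContinuousLinearMap.rayleighQuotient, hx, div_mul_cancel₀ _ hpos.ne']
  simpa [ContinuousLinearMap.reApplyInnerSelf_apply] using h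

theorem norm_sq_apply_le_of_inner_le {B : W →L[ℝ] W} {M : ℝ} (hM : 0 < M)
    (hsym : ∀ x y, inner ℝ (B x) y = inner ℝ x (B y)) (h0 : ∀ w, 0 ≤ inner ℝ (B w) w)
    (h1 : ∀ w, inner ℝ (B w) w ≤ M * ‖w‖ ^ 2) (y : W) : ‖B y‖ ^ 2 ≤ M * inner ℝ (B y) y := by
  -- Positivity at M y - B y gives M²⟨By, y⟩ - 2M‖By‖² + ⟨B(By), By⟩ ≥ 0, and the last term is at
  -- most M‖By‖².
  have h2 := h0 (M • y - B y)
  have h3 := h1 (B y)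
  have e1 : inner ℝ (B (B y)) y = ‖B y‖ ^ 2 := by rw [hsym, real_inner_self_eq_norm_sq]
  simp only [map_sub, map_smul, inner_sub_left, inner_sub_right, real_inner_smul_left,
    real_inner_smul_right, real_inner_self_eq_norm_sq, e1] at h2
  nlinarith

/-- Both bounds come from testing at Gi w, where ⟨G(Gi w), Gi w⟩ = ⟨Gi w, w⟩. The lower one is ‖G
y‖² ≤ M⟨G y, y⟩; the upper one combines coercivity with Cauchy–Schwarz. -/
theorem inner_inv_bounds {G Gi : W →L[ℝ] W} {l M : ℝ} (hl : 0 < l) (hM : 0 < M)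
    (hsym : ∀ x y, inner ℝ (G x) y = inner ℝ x (G y)) (hinv : ∀ w, G (Gi w) = w)
    (h0 : ∀ w, l * ‖w‖ ^ 2 ≤ inner ℝ (G w) w) (h1 : ∀ w, inner ℝ (G w) w ≤ M * ‖w‖ ^ 2) (w : W) :
    1 / M * ‖w‖ ^ 2 ≤ inner ℝ (Gi w) w ∧ inner ℝ (Gi w) w ≤ 1 / l * ‖w‖ ^ 2 := by
  have hpos : ∀ w, 0 ≤ inner ℝ (G w) w := fun w => le_trans (by positivity) (h0 w)
  have e : inner ℝ (G (Gi w)) (Gi w) = inner ℝ (Gi w) w := by rw [hinv, real_inner_comm]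
  constructor
  · have h2 := norm_sq_apply_le_of_inner_le hM hsym hpos h1 (Gi w)
    rw [e, hinv] at h2
    rw [div_mul_eq_mul_div, one_mul, div_le_iff₀ hM]
    linarith
  · have h2 := h0 (Gi w)
    rw [e] at h2
    have h3 := real_inner_le_norm (Gi w) w
    rw [div_mul_eq_mul_div, one_mul, le_div_iff₀ hl]
    nlinarith [sq_nonneg (l * ‖Gi w‖ - ‖w‖), norm_nonneg w, norm_nonneg (Gi w)]

theorem opNorm_le_of_inner_le {B : W →L[ℝ] W} {M : ℝ} (hM : 0 < M)
    (hsym : ∀ x y, inner ℝ (B x) y = inner ℝ x (B y)) (h0 : ∀ w, 0 ≤ inner ℝ (B w) w)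
    (h1 : ∀ w, inner ℝ (B w) w ≤ M * ‖w‖ ^ 2) : ‖B‖ ≤ M := by
  refine B.opNorm_le_bound hM.le fun y => ?_
  have h2 := norm_sq_apply_le_of_inner_le hM hsym h0 h1 y
  have h3 := real_inner_le_norm (B y) y
  rcases (norm_nonneg (B y)).eq_or_lt with h | h
  · rw [← h]; positivity
  · have h4 : ‖B y‖ * ‖B y‖ ≤ ‖B y‖ * (M * ‖y‖) := by nlinarith
    exact le_of_mul_le_mul_left h4 h

theorem opNorm_le_of_le_inner_inv {G Gi : W →L[ℝ] W} {M : ℝ} (hM : 0 < M)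
    (hinv : ∀ w, Gi (G w) = w) (h : ∀ w, 1 / M * ‖w‖ ^ 2 ≤ inner ℝ (Gi w) w) : ‖G‖ ≤ M := by
  refine G.opNorm_le_bound hM.le fun y => ?_
  have h2 := h (G y)
  rw [hinv, div_mul_eq_mul_div, one_mul, div_le_iff₀ hM] at h2
  have h3 := real_inner_le_norm y (G y)
  rcases (norm_nonneg (G y)).eq_or_lt with h | h
  · rw [← h]; positivity
  · have h4 : ‖G y‖ * ‖G y‖ ≤ ‖G y‖ * (M * ‖y‖) := by nlinarith
    exact le_of_mul_le_mul_left h4 h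

theorem inner_inv_pos {G Gi : W →L[ℝ] W} {M : ℝ} (hM : 0 < M)
    (hinv : ∀ w, Gi (G w) = w) (h : ∀ w, 1 / M * ‖w‖ ^ 2 ≤ inner ℝ (Gi w) w) {w : W}
    (hw : w ≠ 0) : 0 < inner ℝ w (G w) := by
  have h2 := h (G w)
  rw [hinv] at h2
  have h3 : G w ≠ 0 := fun h0 => hw (by rw [← hinv w, h0, map_zero])
  exact lt_of_lt_of_le (by positivity) h2

variable [FiniteDimensional ℝ W]

theorem bddBelow_spectrum (B : W →L[ℝ] W) : BddBelow (spectrum ℝ B) :=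
  haveI := FiniteDimensional.complete ℝ W
  (spectrum.isCompact B).bddBelow

theorem bddAbove_spectrum (B : W →L[ℝ] W) : BddAbove (spectrum ℝ B) :=
  haveI := FiniteDimensional.complete ℝ W
  (spectrum.isCompact B).bddAbove

/-- The quadratic form attains its minimum on a sphere at an eigenvector, whose Rayleigh quotient
lies in the spectrum. Taking the sphere of radius ‖w‖ avoids normalizing `w`. -/
theorem lamMin_mul_le_inner [CompleteSpace W] {B : W →L[ℝ] W} (hB : IsSelfAdjoint B) (w : W) :
    lamMin B * ‖w‖ ^ 2 ≤ inner ℝ (B w) w := by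
  rcases eq_or_ne w 0 with rfl | hw
  · simp
  have := FiniteDimensional.proper_real W
  obtain ⟨x, hx, hmin⟩ := (isCompact_sphere (0 : W) ‖w‖).exists_isMinOn ⟨w, by simp⟩
    B.reApplyInnerSelf_continuous.continuousOn
  have hxn : ‖x‖ = ‖w‖ := by simpa using hx
  have hx0 : x ≠ 0 := by rw [← norm_ne_zero_iff, hxn]; exact norm_ne_zero_iff.2 hw
  have heig : B x = B.rayleighQuotient x • x :=
    hB.eq_smul_self_of_isLocalExtrOn_real (Or.inl (by rw [hxn]; exact hmin.localize))
  have h1 : lamMin B ≤ B.rayleighQuotient x :=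
    csInf_le (bddBelow_spectrum B) (mem_spectrum_of_apply_eq_smul hx0 heig)
  have h2 := inner_le_of_rayleighQuotient_le hw hxn (hmin (by simp : w ∈ Metric.sphere 0 ‖w‖))
  exact (mul_le_mul_of_nonneg_right h1 (by positivity)).trans h2

theorem inner_le_lamMax_mul [CompleteSpace W] {B : W →L[ℝ] W} (hB : IsSelfAdjoint B) (w : W) :
    inner ℝ (B w) w ≤ lamMax B * ‖w‖ ^ 2 := by
  rcases eq_or_ne w 0 with rfl | hw
  · simp
  have := FiniteDimensional.proper_real W
  obtain ⟨x, hx, hmax⟩ := (isCompact_sphere (0 : W) ‖w‖).exists_isMaxOn ⟨w, by simp⟩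
    B.reApplyInnerSelf_continuous.continuousOn
  have hxn : ‖x‖ = ‖w‖ := by simpa using hx
  have hx0 : x ≠ 0 := by rw [← norm_ne_zero_iff, hxn]; exact norm_ne_zero_iff.2 hw
  have heig : B x = B.rayleighQuotient x • x :=
    hB.eq_smul_self_of_isLocalExtrOn_real (Or.inr (by rw [hxn]; exact hmax.localize))
  have h1 : B.rayleighQuotient x ≤ lamMax B :=
    le_csSup (bddAbove_spectrum B) (mem_spectrum_of_apply_eq_smul hx0 heig)
  have h3 : B.reApplyInnerSelf w ≤ B.reApplyInnerSelf x :=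
    hmax (by simp : w ∈ Metric.sphere 0 ‖w‖)
  have hpos : (0 : ℝ) < ‖w‖ ^ 2 := by positivity
  have h2 : inner ℝ (B w) w ≤ B.rayleighQuotient x * ‖w‖ ^ 2 := by
    rw [ContinuousLinearMap.rayleighQuotient, hxn, div_mul_cancel₀ _ hpos.ne']
    simpa [ContinuousLinearMap.reApplyInnerSelf_apply] using h3
  exact h2.trans (mul_le_mul_of_nonneg_right h1 (by positivity))

end Operators

/-! ### Convex functions and the smooth projection -/

section Convex

variable {W : Type*} [NormedAddCommGroup W] [InnerProductSpace ℝ W]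

theorem fderiv_apply_sub_le_of_convexOn {P : W → ℝ} (hP : ConvexOn ℝ univ P) {θ : W}
    (hd : DifferentiableAt ℝ P θ) (w : W) : fderiv ℝ P θ (w - θ) ≤ P w - P θ := by
  have hg : ConvexOn ℝ univ (fun s : ℝ => P (AffineMap.lineMap θ w s)) :=
    hP.comp_affineMap (AffineMap.lineMap θ w : ℝ →ᵃ[ℝ] W)
  have hg' : HasDerivAt (fun s : ℝ => P (AffineMap.lineMap θ w s)) (fderiv ℝ P θ (w - θ)) 0 := by
    have h1 : HasDerivAt (fun s : ℝ => (AffineMap.lineMap θ w s : W)) (w - θ) 0 :=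
      AffineMap.hasDerivAt_lineMap
    have h2 : HasFDerivAt P (fderiv ℝ P θ) ((AffineMap.lineMap θ w : ℝ →ᵃ[ℝ] W) 0) := by
      simpa using hd.hasFDerivAt
    exact h2.comp_hasDerivAt (0 : ℝ) h1
  have h := hg.le_slope_of_hasDerivAt (mem_univ 0) (mem_univ 1) one_pos hg'
  simpa [slope_def_field] using h

theorem isBounded_sublevel_of_convexOn {P : W → ℝ} (hP : ConvexOn ℝ univ P) {c₀ c : ℝ}
    (hb : Bornology.IsBounded {θ | P θ ≤ c₀}) (hs : ∃ θ, P θ < c₀) :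
    Bornology.IsBounded {θ | P θ ≤ c} := by
  obtain ⟨θ₀, h0⟩ := hs
  rcases le_or_gt c c₀ with hc | hc
  · exact hb.subset fun θ (hθ : P θ ≤ c) => hθ.trans hc
  obtain ⟨R, hR⟩ := hb.exists_norm_le
  have hden : 0 < c - P θ₀ := by linarith
  -- The contraction factor towards the Slater point for which (1 - q) P θ₀ + q c = c₀: it maps the
  -- larger sublevel set into the bounded one.
  set q : ℝ := (c₀ - P θ₀) / (c - P θ₀) with hq
  have hq0 : 0 < q := div_pos (by linarith) hden
  have hq1 : q ≤ 1 := (div_le_one hden).2 (by linarith)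
  have hqc : q * (c - P θ₀) = c₀ - P θ₀ := div_mul_cancel₀ _ hden.ne'
  rw [isBounded_iff_forall_norm_le]
  refine ⟨(R + ‖θ₀‖) / q, fun θ (hθ : P θ ≤ c) => ?_⟩
  have h1 := hP.2 (mem_univ θ₀) (mem_univ θ) (by linarith : 0 ≤ 1 - q) hq0.le (by ring)
  have h2 : P ((1 - q) • θ₀ + q • θ) ≤ c₀ := by
    refine h1.trans ?_
    simp only [smul_eq_mul]
    nlinarith
  have h3 := hR _ h2
  rw [le_div_iff₀ hq0]
  have h4 : ‖q • θ‖ ≤ ‖(1 - q) • θ₀ + q • θ‖ + ‖(1 - q) • θ₀‖ := by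
    have := norm_sub_le ((1 - q) • θ₀ + q • θ) ((1 - q) • θ₀)
    simpa using this
  rw [norm_smul, norm_smul, Real.norm_of_nonneg hq0.le,
    Real.norm_of_nonneg (by linarith : 0 ≤ 1 - q)] at h4
  nlinarith [norm_nonneg θ₀]

variable [CompleteSpace W]

/-- From the outer edge of the boundary layer on, the factor min {1, P/ε} saturates at 1 and the
outward component is removed exactly. This keeps the estimate in {P ≤ ε}. -/
theorem inner_gradient_proj_nonpos {P : W → ℝ} {ε : ℝ} (hε : 0 < ε) {G : W →L[ℝ] W} {θ : W}
    (hG : gradient P θ ≠ 0 → 0 < inner ℝ (gradient P θ) (G (gradient P θ))) (hθ : ε ≤ P θ)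
    (τ : W) : inner ℝ (gradient P θ) (proj P ε G θ τ) ≤ 0 := by
  unfold proj
  split_ifs with h
  · exact h.resolve_left (not_le.2 (hε.trans_le hθ))
  · rw [not_or, not_le, not_le] at h
    have hne : gradient P θ ≠ 0 := by
      intro h0
      rw [h0, inner_zero_left] at h
      exact lt_irrefl _ h.2
    have h1 : min 1 (P θ / ε) = 1 := min_eq_left ((one_le_div hε).2 hθ)
    rw [h1, inner_sub_right, real_inner_smul_right, one_mul, div_mul_cancel₀ _ (hG hne).ne',
      sub_self]

/-- The projection does not destroy the negativity of the Lyapunov derivative. -/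
theorem inner_inv_le_inner_inv_proj {P : W → ℝ} (hP : ConvexOn ℝ univ P) {ε : ℝ} (hε : 0 < ε)
    {G Gi : W →L[ℝ] W} {θ w : W} (hd : DifferentiableAt ℝ P θ) (hinv : ∀ w, Gi (G w) = w)
    (hG : 0 ≤ inner ℝ (gradient P θ) (G (gradient P θ))) (hw : P w ≤ 0) (τ : W) :
    inner ℝ (w - θ) (Gi τ) ≤ inner ℝ (w - θ) (Gi (proj P ε G θ τ)) := by
  unfold proj
  split_ifs with h
  · exact le_rfl
  · rw [not_or, not_le, not_le] at h
    -- Since P w ≤ 0 < P θ, convexity makes ∇P(θ) point away from w. As `Gi` cancels `G`, the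
    -- correction term is a nonnegative multiple of this inner product and enters with a minus sign.
    have h1 : inner ℝ (w - θ) (gradient P θ) ≤ 0 := by
      have h2 := fderiv_apply_sub_le_of_convexOn hP hd w
      have h3 : inner ℝ (gradient P θ) (w - θ) = fderiv ℝ P θ (w - θ) := by
        simp [gradient]
      rw [real_inner_comm, h3]
      linarith
    have hc : 0 ≤ min 1 (P θ / ε) *
        (inner ℝ (gradient P θ) τ / inner ℝ (gradient P θ) (G (gradient P θ))) :=
      mul_nonneg (le_min zero_le_one (div_pos h.1 hε).le) (div_nonneg h.2.le hG)
    rw [map_sub, map_smul, hinv, inner_sub_right, real_inner_smul_right]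
    nlinarith

end Convex

/-! ### Smoothness of the network -/

namespace Arch

variable {A : Arch}

theorem norm_sq_pair (x v : A.Vec) : ‖pair x v‖ ^ 2 = ‖x‖ ^ 2 + ‖v‖ ^ 2 := by
  simp [EuclideanSpace.norm_sq_eq, pair, Fin.sum_univ_add, -Fin.natAdd_eq_addNat]

theorem norm_pair_le (x v : A.Vec) : ‖pair x v‖ ≤ ‖x‖ + ‖v‖ := by
  have h := norm_sq_pair x v
  nlinarith [norm_nonneg x, norm_nonneg v, norm_nonneg (pair x v),
    mul_nonneg (norm_nonneg x) (norm_nonneg v)]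

theorem norm_sq_err (r e : A.Vec) (w : A.Par) :
    ‖err r e w‖ ^ 2 = ‖r‖ ^ 2 + ‖e‖ ^ 2 + ‖w‖ ^ 2 := by
  rw [err, WithLp.prod_norm_sq_eq_of_L2, WithLp.prod_norm_sq_eq_of_L2, ← add_assoc]
  rfl

theorem norm_le_norm_err (r e : A.Vec) (w : A.Par) :
    ‖r‖ ≤ ‖err r e w‖ ∧ ‖e‖ ≤ ‖err r e w‖ ∧ ‖w‖ ≤ ‖err r e w‖ := by
  have h := norm_sq_err r e w
  refine ⟨?_, ?_, ?_⟩ <;> refine abs_le_of_sq_le_sq' ?_ (norm_nonneg _) |>.2 <;>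
    nlinarith [sq_nonneg ‖r‖, sq_nonneg ‖e‖, sq_nonneg ‖w‖]

/-- Concatenation as a continuous linear map. -/
noncomputable def pairL : A.Vec × A.Vec →L[ℝ] A.Inp :=
  LinearMap.toContinuousLinearMap
    { toFun := fun q => pair q.1 q.2
      map_add' := fun q q' => by
        ext i
        refine Fin.addCases (fun j => ?_) (fun j => ?_) i <;> simp [pair, -Fin.natAdd_eq_addNat]
      map_smul' := fun c q => by
        ext i
        refine Fin.addCases (fun j => ?_) (fun j => ?_) i <;> simp [pair, -Fin.natAdd_eq_addNat] }

theorem contDiff_layer {ς : ℕ → ℕ → ℝ → ℝ}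
    (hς : ∀ j i, 1 ≤ j → j ≤ A.k → ContDiff ℝ ∞ (ς j i)) :
    ∀ j ≤ A.k, ContDiff ℝ ∞ (fun q : A.Inp × A.Par => layer ς q.1 q.2 j)
  | 0, _ => by
    refine contDiff_pi.2 fun b => ?_
    simp only [layer, Matrix.mulVec, dotProduct, Matrix.transpose_apply]
    refine ContDiff.sum fun a _ => ContDiff.mul ?_ ?_
    · simp only [weight]
      split_ifs <;> fun_prop
    · simp only [augment]
      split_ifs <;> fun_prop
  | j + 1, hj => by
    have ih := contDiff_pi.1 (contDiff_layer hς j (by omega))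
    refine contDiff_pi.2 fun b => ?_
    simp only [layer, Matrix.mulVec, dotProduct, Matrix.transpose_apply]
    refine ContDiff.sum fun a _ => ContDiff.mul ?_ ?_
    · simp only [weight]
      split_ifs <;> fun_prop
    · simp only [act]
      split_ifs
      · fun_prop
      · exact (hς (j + 1) a (by omega) hj).comp (ih a)

theorem layer_zero (ς : ℕ → ℕ → ℝ → ℝ) (X : A.Inp) (j : ℕ) :
    layer ς X (0 : A.Par) j = 0 := by
  have h : ∀ j, weight (0 : A.Par) j = 0 := fun j => by
    ext a b
    simp [weight]
  cases j <;> simp [layer, h]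

end Arch

namespace Problem

variable {A : Arch} (p : Problem A)

theorem contDiff_Φ : ContDiff ℝ ∞ (fun q : A.Inp × A.Par => p.Φ q.1 q.2) :=
  (PiLp.contDiff_toLp (𝕜 := ℝ) (p := 2)).comp (Arch.contDiff_layer p.ς_smooth A.k le_rfl)

theorem Φ_zero (X : A.Inp) : p.Φ X 0 = 0 := by
  simp [Φ, Arch.layer_zero]

theorem contDiff_J : ContDiff ℝ ∞ (fun q : A.Inp × A.Par => p.J q.1 q.2) := by
  unfold J
  refine ContDiff.fderiv (f := fun (q : A.Inp × A.Par) (w : A.Par) => p.Φ q.1 w) (m := ∞) ?_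
    contDiff_snd le_rfl
  exact p.contDiff_Φ.comp (f := fun z : (A.Inp × A.Par) × A.Par => (z.1.1, z.2)) (by fun_prop)

theorem hasFDerivAt_Φ (X : A.Inp) (θ : A.Par) : HasFDerivAt (fun w => p.Φ X w) (p.J X θ) θ := by
  have h : ContDiff ℝ ∞ (fun w => p.Φ X w) :=
    p.contDiff_Φ.comp (f := fun w : A.Par => (X, w)) (by fun_prop)
  exact (h.differentiable (by simp)).differentiableAt.hasFDerivAt

/-- The second derivative of the network in the weights. -/
noncomputable def J₂ (X : A.Inp) (θ : A.Par) : A.Par →L[ℝ] A.Par →L[ℝ] A.Vec :=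
  fderiv ℝ (fun w => p.J X w) θ

theorem contDiff_J₂ : ContDiff ℝ ∞ (fun q : A.Inp × A.Par => p.J₂ q.1 q.2) := by
  unfold J₂
  refine ContDiff.fderiv (f := fun (q : A.Inp × A.Par) (w : A.Par) => p.J q.1 w) (m := ∞) ?_
    contDiff_snd le_rfl
  exact p.contDiff_J.comp (f := fun z : (A.Inp × A.Par) × A.Par => (z.1.1, z.2)) (by fun_prop)

theorem hasFDerivAt_J (X : A.Inp) (θ : A.Par) : HasFDerivAt (fun w => p.J X w) (p.J₂ X θ) θ := by
  have h : ContDiff ℝ ∞ (fun w => p.J X w) :=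
    p.contDiff_J.comp (f := fun w : A.Par => (X, w)) (by fun_prop)
  exact (h.differentiable (by simp)).differentiableAt.hasFDerivAt

theorem continuous_Φ : Continuous (fun q : A.Inp × A.Par => p.Φ q.1 q.2) := p.contDiff_Φ.continuous

theorem continuous_J : Continuous (fun q : A.Inp × A.Par => p.J q.1 q.2) := p.contDiff_J.continuous

theorem continuous_JT : Continuous (fun q : A.Inp × A.Par => p.JT q.1 q.2) :=
  ContinuousLinearMap.adjoint.continuous.comp p.continuous_J

theorem norm_JT (X : A.Inp) (θ : A.Par) : ‖p.JT X θ‖ = ‖p.J X θ‖ :=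
  ContinuousLinearMap.adjoint.norm_map _

theorem convex_Θε : Convex ℝ p.Θε := by
  simpa [Θε] using p.P_convex.convex_le p.εP

theorem isCompact_Θε : IsCompact p.Θε :=
  Metric.isCompact_of_isClosed_isBounded (isClosed_le p.P_C1.continuous continuous_const)
    (isBounded_sublevel_of_convexOn p.P_convex p.P_compact.isBounded p.P_slater)

theorem θs_mem_Θε : p.θs ∈ p.Θε := p.θs_mem.trans p.εP_pos.le

theorem xdB_nonneg : 0 ≤ p.xdB := (norm_nonneg _).trans (p.xd_le p.t₀ le_rfl)

theorem xdB'_nonneg : 0 ≤ p.xdB' := (norm_nonneg _).trans (p.xd'_le p.t₀ le_rfl)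

/-- The factor α₁ + 2 collects ‖e‖ from the position and ‖r‖ + α₁‖e‖ from the velocity. -/
theorem norm_inputOf_le {t : ℝ} (ht : p.t₀ ≤ t) (r e : A.Vec) (w : A.Par) :
    ‖p.inputOf t r e‖ ≤ (p.α₁ + 2) * ‖Arch.err r e w‖ + p.xdB + p.xdB' := by
  obtain ⟨hr, he, -⟩ := Arch.norm_le_norm_err r e w
  have h1 : ‖e + p.xd t‖ ≤ ‖e‖ + p.xdB := (norm_add_le _ _).trans (by linarith [p.xd_le t ht])
  have h2 : ‖r - p.α₁ • e + deriv p.xd t‖ ≤ ‖r‖ + p.α₁ * ‖e‖ + p.xdB' := by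
    refine (norm_add_le _ _).trans (add_le_add ((norm_sub_le _ _).trans ?_) (p.xd'_le t ht))
    rw [norm_smul, Real.norm_of_nonneg p.α₁_pos.le]
  have h3 := Arch.norm_pair_le (e + p.xd t) (r - p.α₁ • e + deriv p.xd t)
  have h4 := mul_le_mul_of_nonneg_left he p.α₁_pos.le
  unfold inputOf
  linarith

/-! ### Existence of the bounding functions -/

theorem IncrNonneg.mul {ρ ρ' : ℝ → ℝ} (h : IncrNonneg ρ) (h' : IncrNonneg ρ') :
    IncrNonneg (fun s => ρ s * ρ' s) :=
  ⟨fun a ha _ hb hab => mul_lt_mul'' (h.1 ha hb hab) (h'.1 ha hb hab) (h.2 a ha) (h'.2 a ha),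
    fun s hs => mul_nonneg (h.2 s hs) (h'.2 s hs)⟩

theorem IncrNonneg.comp_affine {ρ : ℝ → ℝ} (h : IncrNonneg ρ) {m c : ℝ} (hm : 0 < m)
    (hc : 0 ≤ c) : IncrNonneg (fun s => ρ (m * s + c)) := by
  have h0 : ∀ s, 0 ≤ s → 0 ≤ m * s + c := fun s hs => by positivity
  exact ⟨fun a ha b hb hab => h.1 (h0 a ha) (h0 b hb)
    (by linarith [mul_lt_mul_of_pos_left hab hm]), fun s hs => h.2 _ (h0 s hs)⟩

theorem IncrNonneg.le {ρ : ℝ → ℝ} (h : IncrNonneg ρ) {a b : ℝ} (ha : 0 ≤ a) (hab : a ≤ b) :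
    ρ a ≤ ρ b := h.1.monotoneOn ha (ha.trans hab : (0 : ℝ) ≤ b) hab

theorem exists_incrNonneg_bound {E F : Type*} [NormedAddCommGroup E] [ProperSpace E]
    [TopologicalSpace F] {g : E × F → ℝ} (hg : Continuous g) {K : Set F} (hK : IsCompact K) :
    ∃ ρ, IncrNonneg ρ ∧ ∀ X, ∀ θ ∈ K, g (X, θ) ≤ ρ ‖X‖ := by
  have hb : ∀ s, BddAbove (insert 0 (g '' (Metric.closedBall 0 s ×ˢ K))) := fun s =>
    (((isCompact_closedBall (0 : E) s).prod hK).image hg).bddAbove.insert 0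
  -- The supremum over growing balls is only monotone; the summand s makes it strictly increasing.
  -- Inserting 0 gives nonnegativity and covers an empty `K`.
  refine ⟨fun s => s + sSup (insert 0 (g '' (Metric.closedBall 0 s ×ˢ K))), ⟨?_, ?_⟩, ?_⟩
  · intro a _ b _ hab
    refine add_lt_add_of_lt_of_le hab (csSup_le_csSup (hb b) (insert_nonempty _ _) ?_)
    exact insert_subset_insert (image_mono (prod_mono (Metric.closedBall_subset_closedBall hab.le)
      subset_rfl))
  · intro s hs
    exact add_nonneg hs (le_csSup (hb s) (mem_insert _ _))
  · intro X θ hθ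
    have h1 : g (X, θ) ≤ sSup (insert 0 (g '' (Metric.closedBall 0 ‖X‖ ×ˢ K))) :=
      le_csSup (hb _) (mem_insert_of_mem _ (mem_image_of_mem g ⟨by simp, hθ⟩))
    linarith [norm_nonneg X]

/-- The mean value inequality is used twice: it makes the Jacobian M-Lipschitz on `K`, and then
bounds the network minus its linearization along the segment. The factor ½ of Taylor's formula is
not needed. -/
theorem norm_rem_le {X : A.Inp} {θ w : A.Par} {K : Set A.Par} (hK : Convex ℝ K) {M : ℝ}
    (hM : ∀ v ∈ K, ‖p.J₂ X v‖ ≤ M) (hθ : θ ∈ K) (hw : w ∈ K) :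
    ‖p.rem X θ w‖ ≤ M * ‖w - θ‖ ^ 2 := by
  have hM0 : 0 ≤ M := (ContinuousLinearMap.opNorm_nonneg _).trans (hM θ hθ)
  have hseg : segment ℝ θ w ⊆ K := hK.segment_subset hθ hw
  have hbound : ∀ v ∈ segment ℝ θ w, ‖p.J X v - p.J X θ‖ ≤ M * ‖w - θ‖ := fun v hv => by
    have h1 := hK.norm_image_sub_le_of_norm_hasFDerivWithin_le
      (fun v _ => (p.hasFDerivAt_J X v).hasFDerivWithinAt) hM hθ (hseg hv)
    have h2 : ‖v - θ‖ ≤ ‖w - θ‖ := norm_sub_le_of_mem_segment hv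
    exact h1.trans (mul_le_mul_of_nonneg_left h2 hM0)
  have h := (convex_segment θ w).norm_image_sub_le_of_norm_hasFDerivWithin_le'
    (fun v _ => (p.hasFDerivAt_Φ X v).hasFDerivWithinAt) hbound (left_mem_segment ℝ θ w)
    (right_mem_segment ℝ θ w)
  rw [pow_two, ← mul_assoc]
  exact h

theorem exists_isBounding : ∃ ρ₁ ρ₂ ρ₃ ρ₅ : ℝ → ℝ, p.IsBounding ρ₁ ρ₂ ρ₃ ρ₅ := by
  obtain ⟨ρ₁, i₁, h₁⟩ := exists_incrNonneg_bound p.continuous_J.norm p.isCompact_Θε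
  have hc₂ : Continuous (fun q : A.Inp × A.Par => ‖p.J₂ q.1 q.2‖) :=
    Continuous.norm (E := A.Par →L[ℝ] A.Par →L[ℝ] A.Vec) p.contDiff_J₂.continuous
  obtain ⟨ρ₂, i₂, h₂⟩ := exists_incrNonneg_bound hc₂ p.isCompact_Θε
  have hc : Continuous (fun q : A.Inp × A.Par =>
      ‖p.JT q.1 q.2 (p.appErr q.1 - p.rem q.1 q.2 0)‖) := by
    have e1 : Continuous (fun q : A.Inp × A.Par => p.Φ q.1 p.θs) :=
      p.continuous_Φ.comp (f := fun q : A.Inp × A.Par => (q.1, p.θs)) (by fun_prop)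
    have e2 : Continuous (fun q : A.Inp × A.Par => p.f q.1) :=
      p.f_C1.continuous.comp continuous_fst
    have e3 : Continuous (fun q : A.Inp × A.Par => p.J q.1 q.2 (0 - q.2)) :=
      p.continuous_J.clm_apply (by fun_prop)
    have e4 : Continuous (fun q : A.Inp × A.Par => p.Φ q.1 0) :=
      p.continuous_Φ.comp (f := fun q : A.Inp × A.Par => (q.1, 0)) (by fun_prop)
    exact (p.continuous_JT.clm_apply
      ((e2.sub e1).sub ((e4.sub p.continuous_Φ).sub e3))).norm
  obtain ⟨ρ₅, i₅, h₅⟩ := exists_incrNonneg_bound hc p.isCompact_Θε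
  have hm : 0 < p.α₁ + 2 := by linarith [p.α₁_pos]
  have hd : 0 ≤ p.xdB + p.xdB' := add_nonneg p.xdB_nonneg p.xdB'_nonneg
  have hX : ∀ {t}, p.t₀ ≤ t → ∀ (r e : A.Vec) (w : A.Par),
      ‖p.inputOf t r e‖ ≤ (p.α₁ + 2) * ‖Arch.err r e w‖ + (p.xdB + p.xdB') := fun ht r e w => by
    linarith [p.norm_inputOf_le ht r e w]
  have hrem : ∀ X, ∀ w : A.Par, p.θs - w ∈ p.Θε →
      ‖p.rem X (p.θs - w) p.θs‖ ≤ ρ₂ ‖X‖ * ‖w‖ ^ 2 := fun X w hw => by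
    simpa using p.norm_rem_le p.convex_Θε (fun v hv => h₂ X v hv) hw p.θs_mem_Θε
  -- Bounds in terms of ‖X‖ become bounds in terms of ‖ζ‖ through ‖X‖ ≤ (α₁ + 2)‖ζ‖ + const. The
  -- product ρ₁ρ₂ bounds the transposed Jacobian times the second derivative.
  refine ⟨ρ₁, _, _, ρ₅, i₁, i₂.comp_affine hm hd, (i₁.mul i₂).comp_affine hm hd, i₅, h₁, ?_, ?_,
    h₅⟩
  · intro t ht r e w hw
    refine (hrem _ w hw).trans ?_
    have h3 := i₂.le (norm_nonneg _) (hX ht r e w)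
    have h4 := (Arch.norm_le_norm_err r e w).2.2
    gcongr
    exact i₂.2 _ (by positivity)
  · intro t ht ri ei wi r e w hw
    have h3 := (i₁.mul i₂).le (norm_nonneg _) (hX ht ri ei wi)
    have h4 := (Arch.norm_le_norm_err r e w).2.2
    have h5 : ‖p.JT (p.inputOf t ri ei) (p.θs - w)‖ ≤ ρ₁ ‖p.inputOf t ri ei‖ := by
      rw [norm_JT]; exact h₁ _ _ hw
    calc _ ≤ ‖p.JT (p.inputOf t ri ei) (p.θs - w)‖ * ‖p.rem (p.inputOf t ri ei) (p.θs - w) p.θs‖ :=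
          ContinuousLinearMap.le_opNorm _ _
      _ ≤ ρ₁ ‖p.inputOf t ri ei‖ * (ρ₂ ‖p.inputOf t ri ei‖ * ‖w‖ ^ 2) :=
          mul_le_mul h5 (hrem _ w hw) (norm_nonneg _) ((norm_nonneg _).trans h5)
      _ = (ρ₁ ‖p.inputOf t ri ei‖ * ρ₂ ‖p.inputOf t ri ei‖) * ‖w‖ ^ 2 := by ring
      _ ≤ _ := mul_le_mul h3 (by gcongr) (by positivity)
          ((i₁.mul i₂).2 _ (by positivity))

theorem exists_isFdotBound (χ : ℝ) : ∃ δf : ℝ, 0 < δf ∧ p.IsFdotBound χ δf := by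
  let V := A.Vec
  -- Time enters only through x_d, ẋ_d and ẍ_d. Treating these as free variables in balls turns the
  -- bound into one for a continuous function on a compact set.
  let X : (V × V × V) × (V × V × A.Par) → A.Inp := fun q =>
    Arch.pairL (q.2.2.1 + q.1.1, q.2.1 - p.α₁ • q.2.2.1 + q.1.2.1)
  have hX : Continuous X := Arch.pairL.continuous.comp (by fun_prop)
  have hΦ : Continuous (fun q => p.Φ (X q) (p.θs - q.2.2.2)) :=
    p.continuous_Φ.comp (f := fun q => (X q, p.θs - q.2.2.2)) (by fun_prop)
  have hf : Continuous (fun q => p.f (X q)) := p.f_C1.continuous.comp hX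
  have hf' : Continuous (fun q => fderiv ℝ p.f (X q)) :=
    (p.f_C1.continuous_fderiv one_ne_zero).comp hX
  let Y : (V × V × V) × (V × V × A.Par) → A.Vec := fun q =>
    p.f (X q) + (q.1.2.2 - p.Φ (X q) (p.θs - q.2.2.2) - p.k₁ • q.2.1 - q.2.2.1
      - p.α₁ • (q.2.1 - p.α₁ • q.2.2.1))
  have hY : Continuous Y := by fun_prop
  have hg : Continuous (fun q => fderiv ℝ p.f (X q)
      (Arch.pairL (q.2.1 - p.α₁ • q.2.2.1 + q.1.2.1, Y q))) :=
    hf'.clm_apply (Arch.pairL.continuous.comp (by fun_prop))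
  have hK : IsCompact ((Metric.closedBall (0 : V) p.xdB ×ˢ Metric.closedBall (0 : V) p.xdB' ×ˢ
      Metric.closedBall (0 : V) p.xdB'') ×ˢ (Metric.closedBall (0 : V) χ ×ˢ
      Metric.closedBall (0 : V) χ ×ˢ Metric.closedBall (0 : A.Par) χ)) :=
    ((isCompact_closedBall _ _).prod ((isCompact_closedBall _ _).prod
      (isCompact_closedBall _ _))).prod ((isCompact_closedBall _ _).prod
      ((isCompact_closedBall _ _).prod (isCompact_closedBall _ _)))
  obtain ⟨C, hC⟩ := hK.exists_bound_of_continuousOn hg.continuousOn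
  refine ⟨max C 1, lt_max_of_lt_right one_pos, fun t ht r e w hz => ?_⟩
  have hz' : ‖Arch.err r e w‖ ≤ χ := hz
  obtain ⟨h1, h2, h3⟩ := Arch.norm_le_norm_err r e w
  refine le_trans ?_ (le_max_left C 1)
  refine hC ((p.xd t, deriv p.xd t, deriv (deriv p.xd) t), (r, e, w)) ⟨⟨?_, ?_, ?_⟩, ?_, ?_, ?_⟩
  · simpa using p.xd_le t ht
  · simpa using p.xd'_le t ht
  · simpa using p.xd''_le t ht
  · simpa using h1.trans hz'
  · simpa using h2.trans hz'
  · simpa using h3.trans hz'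

end Problem

/-! ### Properties of closed-loop solutions -/

theorem span_of_le {t₀ : ℝ} {b : EReal} {c t : ℝ} (hc : c ∈ span t₀ b) (h0 : t₀ ≤ t)
    (h : t ≤ c) : t ∈ span t₀ b :=
  ⟨h0, lt_of_le_of_lt (EReal.coe_le_coe_iff.2 h) hc.2⟩

theorem Icc_subset_span {t₀ : ℝ} {b : EReal} {c : ℝ} (hc : c ∈ span t₀ b) :
    Icc t₀ c ⊆ span t₀ b := fun _ ht => span_of_le hc ht.1 ht.2

theorem inner_comm_inv {W : Type*} [NormedAddCommGroup W] [InnerProductSpace ℝ W]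
    {G Gi : W →L[ℝ] W} (hG : ∀ x y, inner ℝ (G x) y = inner ℝ x (G y))
    (hinv : ∀ w, G (Gi w) = w) (x y : W) : inner ℝ (Gi x) y = inner ℝ x (Gi y) := by
  conv_lhs => rw [← hinv y]
  rw [← hG, hinv]

namespace Signals

variable {A : Arch} {N : ℕ} (s : Signals A N) (p : Problem A)

theorem inner_gram (t : ℝ) (x y : A.Par) : inner ℝ (s.gram p t x) y =
    ∑ i ∈ s.stack t, inner ℝ (p.J (s.X (s.ts i)) (s.θh t) x) (p.J (s.X (s.ts i)) (s.θh t) y) := by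
  simp [gram, Problem.JT, sum_inner, ContinuousLinearMap.adjoint_inner_left]

theorem gram_symm (t : ℝ) (x y : A.Par) :
    inner ℝ (s.gram p t x) y = inner ℝ x (s.gram p t y) := by
  rw [real_inner_comm (s.gram p t y) x, inner_gram, inner_gram]
  exact Finset.sum_congr rfl fun i _ => real_inner_comm _ _

theorem isSelfAdjoint_gram (t : ℝ) : IsSelfAdjoint (s.gram p t) :=
  ContinuousLinearMap.isSelfAdjoint_iff_isSymmetric.2 fun x y => s.gram_symm p t x y

theorem X_eq_inputOf (t : ℝ) : s.X t = p.inputOf t (s.r p t) (s.e p t) := by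
  simp [X, Problem.inputOf, r, e, edot]

theorem u_eq_ctrl (t : ℝ) : s.u p t = p.ctrl t (s.r p t) (s.e p t) (s.θh t) := by
  have h : s.r p t - p.α₁ • s.e p t = s.edot p t := by simp [r]
  rw [u, Problem.ctrl, h, ← X_eq_inputOf]

end Signals

namespace IsClosedLoop

variable {A : Arch} {N : ℕ} {p : Problem A} {s : Signals A N} {b : EReal} {δf : ℝ}

theorem Γ_Γinv (h : IsClosedLoop p s b δf)
    {t : ℝ} (ht : t ∈ span p.t₀ b) (w : A.Par) : s.Γ t (s.Γinv t w) = w :=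
  DFunLike.congr_fun (h.Γ_inv t ht).1 w

theorem Γinv_Γ (h : IsClosedLoop p s b δf)
    {t : ℝ} (ht : t ∈ span p.t₀ b) (w : A.Par) : s.Γinv t (s.Γ t w) = w :=
  DFunLike.congr_fun (h.Γ_inv t ht).2 w

theorem t₀_mem (h : IsClosedLoop p s b δf) : p.t₀ ∈ span p.t₀ b := ⟨le_rfl, h.nonempty⟩

/-! ### Invariants of the adaptation: symmetry and spectral bounds of the gain, confinement of the
estimate. -/

/-- The Gram matrix is symmetric, so the asymmetry φ = ⟨Γ⁻¹x, y⟩ - ⟨x, Γ⁻¹y⟩ satisfies φ' = -cφ with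
c ∈ {β, 0}. Thus φ² is nonincreasing, and it starts at 0. -/
theorem Γinv_symm (h : IsClosedLoop p s b δf) {t : ℝ} (ht : t ∈ span p.t₀ b) (x y : A.Par) :
    inner ℝ (s.Γinv t x) y = inner ℝ x (s.Γinv t y) := by
  let φ : (A.Par →L[ℝ] A.Par) →L[ℝ] ℝ :=
    (innerSL ℝ y).comp (ContinuousLinearMap.apply ℝ A.Par x)
      - (innerSL ℝ x).comp (ContinuousLinearMap.apply ℝ A.Par y)
  have hφ : ∀ M, φ M = inner ℝ (M x) y - inner ℝ x (M y) := fun M => by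
    simp [φ, real_inner_comm]
  have hac := (h.Γ_law.hasACDeriv ht).clm_comp ht.1 φ
  have h0 : φ (s.Γinv p.t₀) = 0 := by
    rw [hφ, sub_eq_zero]
    exact inner_comm_inv (fun x y =>
      ContinuousLinearMap.isSelfAdjoint_iff_isSymmetric.1 h.Γ_init.1 x y)
      (h.Γ_Γinv h.t₀_mem) x y
  have hle := (hac.inner ht.1 hac).le_of_nonpos ht.1 fun τ _ => by
    have hrhs : ∃ c : ℝ, 0 ≤ c ∧ φ (s.Γrhs p τ) = -(c * φ (s.Γinv τ)) := by
      unfold Signals.Γrhs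
      split_ifs
      · refine ⟨p.β τ, p.β_nonneg τ, ?_⟩
        have hg : φ (s.gram p τ) = 0 := by rw [hφ, s.gram_symm p, sub_self]
        rw [map_add, map_neg, map_smul, map_smul, hg]
        simp
      · exact ⟨0, le_rfl, by simp⟩
    obtain ⟨c, hc, hce⟩ := hrhs
    rw [hce]
    simp only [RCLike.inner_apply, conj_trivial]
    nlinarith [mul_nonneg hc (sq_nonneg (φ (s.Γinv τ)))]
  rw [h0] at hle
  simp only [RCLike.inner_apply, conj_trivial, mul_zero] at hle
  have h1 : φ (s.Γinv t) = 0 := mul_self_eq_zero.1 (le_antisymm hle (mul_self_nonneg _))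
  rw [hφ] at h1
  linarith

theorem Γ_symm (h : IsClosedLoop p s b δf) {t : ℝ} (ht : t ∈ span p.t₀ b) (x y : A.Par) :
    inner ℝ (s.Γ t x) y = inner ℝ x (s.Γ t y) :=
  inner_comm_inv (h.Γinv_symm ht) (h.Γinv_Γ ht) x y

theorem Γinv_bounds_of_lam (h : IsClosedLoop p s b δf)
    {t : ℝ} (ht : t ∈ span p.t₀ b) (h1 : p.lΓmin ≤ lamMin (s.Γ t))
    (h2 : lamMax (s.Γ t) ≤ p.lΓmax) (w : A.Par) :
    1 / p.lΓmax * ‖w‖ ^ 2 ≤ inner ℝ (s.Γinv t w) w ∧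
      inner ℝ (s.Γinv t w) w ≤ 1 / p.lΓmin * ‖w‖ ^ 2 := by
  have hsa : IsSelfAdjoint (s.Γ t) :=
    ContinuousLinearMap.isSelfAdjoint_iff_isSymmetric.2 fun x y => h.Γ_symm ht x y
  exact inner_inv_bounds p.lΓmin_pos (p.lΓmin_pos.trans_le p.lΓ_le) (h.Γ_symm ht) (h.Γ_Γinv ht)
    (fun w => (mul_le_mul_of_nonneg_right h1 (by positivity)).trans (lamMin_mul_le_inner hsa w))
    (fun w => (inner_le_lamMax_mul hsa w).trans (mul_le_mul_of_nonneg_right h2 (by positivity))) w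

/-- After the last time at which the bounds hold, the eigenvalue condition must fail, since it would
imply them. The law is then frozen, Γ⁻¹ is constant, and the bounds persist. -/
theorem Γinv_bounds (h : IsClosedLoop p s b δf) {t : ℝ} (ht : t ∈ span p.t₀ b) (w : A.Par) :
    1 / p.lΓmax * ‖w‖ ^ 2 ≤ inner ℝ (s.Γinv t w) w ∧
      inner ℝ (s.Γinv t w) w ≤ 1 / p.lΓmin * ‖w‖ ^ 2 := by
  let K : Set (A.Par →L[ℝ] A.Par) := {M | ∀ w, 1 / p.lΓmax * ‖w‖ ^ 2 ≤ inner ℝ (M w) w ∧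
      inner ℝ (M w) w ≤ 1 / p.lΓmin * ‖w‖ ^ 2}
  have hK : IsClosed K := by
    simp only [K, ofPred_forall]
    refine isClosed_iInter fun w => ?_
    have hc : Continuous (fun M : A.Par →L[ℝ] A.Par => inner ℝ (M w) w) := by fun_prop
    exact (isClosed_le continuous_const hc).inter (isClosed_le hc continuous_const)
  by_contra hcon
  have hac := h.Γ_law.hasACDeriv ht
  have hcl : IsClosed (s.Γinv ⁻¹' K ∩ Icc p.t₀ t) := by
    rw [inter_comm]
    exact (hac.continuousOn ht.1).preimage_isClosed_of_isClosed isClosed_Icc hK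
  obtain ⟨c, hc, h0c, hct, hlast⟩ := exists_last_mem hcl ht.1
    (fun w => h.Γinv_bounds_of_lam h.t₀_mem h.Γ_init.2.1 h.Γ_init.2.2 w) (fun hm => hcon (hm w))
  have heq := (hac.mono h0c hct.le le_rfl).eq_of_forall_eq_zero hct.le fun τ hτ => by
    unfold Signals.Γrhs
    rw [if_neg]
    intro hl
    exact hlast τ hτ.1 hτ.2.le fun w => h.Γinv_bounds_of_lam
      (span_of_le ht (h0c.trans hτ.1.le) hτ.2.le) hl.1.le hl.2.le w
  exact hlast t hct le_rfl (by rw [mem_preimage, heq]; exact hc)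

theorem inner_Γ_pos (h : IsClosedLoop p s b δf)
    {t : ℝ} (ht : t ∈ span p.t₀ b) {w : A.Par} (hw : w ≠ 0) :
    0 < inner ℝ w (s.Γ t w) :=
  inner_inv_pos (p.lΓmin_pos.trans_le p.lΓ_le) (h.Γinv_Γ ht) (fun w => (h.Γinv_bounds ht w).1) hw

theorem norm_Γ_le (h : IsClosedLoop p s b δf) {t : ℝ} (ht : t ∈ span p.t₀ b) : ‖s.Γ t‖ ≤ p.lΓmax :=
  opNorm_le_of_le_inner_inv (p.lΓmin_pos.trans_le p.lΓ_le) (h.Γinv_Γ ht)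
    (fun w => (h.Γinv_bounds ht w).1)

theorem norm_Γinv_le (h : IsClosedLoop p s b δf)
    {t : ℝ} (ht : t ∈ span p.t₀ b) : ‖s.Γinv t‖ ≤ 1 / p.lΓmin := by
  have hl := p.lΓmin_pos.trans_le p.lΓ_le
  exact opNorm_le_of_inner_le (one_div_pos.2 p.lΓmin_pos) (h.Γinv_symm ht)
    (fun w => le_trans (by positivity) (h.Γinv_bounds ht w).1) (fun w => (h.Γinv_bounds ht w).2)

/-- After the last time in the set one has P > ε, where the projection makes P(θ̂) nonincreasing; so
P(θ̂) cannot have risen above ε. -/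
theorem θh_mem (h : IsClosedLoop p s b δf) {t : ℝ} (ht : t ∈ span p.t₀ b) : s.θh t ∈ p.Θε := by
  by_contra hcon
  have hac := h.θ_law.hasACDeriv ht
  have hcl : IsClosed (s.θh ⁻¹' p.Θε ∩ Icc p.t₀ t) := by
    rw [inter_comm]
    exact (hac.continuousOn ht.1).preimage_isClosed_of_isClosed isClosed_Icc
      p.isCompact_Θε.isClosed
  obtain ⟨c, hc, h0c, hct, hlast⟩ := exists_last_mem hcl ht.1 h.θ_init hcon
  have hle := ((hac.mono h0c hct.le le_rfl).comp hct.le p.P_C1).le_of_nonpos hct.le fun τ hτ => by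
    have hτ' : p.εP < p.P (s.θh τ) := not_le.1 (hlast τ hτ.1 hτ.2.le)
    have h1 := inner_gradient_proj_nonpos (P := p.P) (G := s.Γ τ) (θ := s.θh τ) p.εP_pos
      (fun hne => h.inner_Γ_pos (span_of_le ht (h0c.trans hτ.1.le) hτ.2.le) hne) hτ'.le
      (s.rawLaw p τ)
    simpa [gradient, Signals.θrhs] using h1
  exact hcon (hle.trans hc)

/-! ### Regularity of the plant signals -/

theorem continuousOn_x (h : IsClosedLoop p s b δf)
    {t : ℝ} (ht : t ∈ span p.t₀ b) : ContinuousOn s.x (Icc p.t₀ t) :=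
  fun τ hτ => ((h.pos τ (Icc_subset_span ht hτ)).continuousWithinAt).mono (Icc_subset_span ht)

theorem continuousOn_v (h : IsClosedLoop p s b δf)
    {t : ℝ} (ht : t ∈ span p.t₀ b) : ContinuousOn s.v (Icc p.t₀ t) :=
  fun τ hτ => ((h.vel τ (Icc_subset_span ht hτ)).continuousWithinAt).mono (Icc_subset_span ht)

theorem continuousOn_acc (h : IsClosedLoop p s b δf) {t : ℝ} (ht : t ∈ span p.t₀ b) :
    ContinuousOn (fun τ => p.f (s.X τ) + s.u p τ) (Icc p.t₀ t) := by
  have hx := h.continuousOn_x ht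
  have hv := h.continuousOn_v ht
  have hθ := (h.θ_law.hasACDeriv ht).continuousOn ht.1
  have hX : ContinuousOn s.X (Icc p.t₀ t) :=
    Arch.pairL.continuous.comp_continuousOn (hx.prodMk hv)
  have hf := p.f_C1.continuous.comp_continuousOn hX
  have hΦ := p.continuous_Φ.comp_continuousOn (hX.prodMk hθ)
  have h0 : ContinuousOn p.xd (Icc p.t₀ t) := p.xd_C2.continuous.continuousOn
  have h1 : ContinuousOn (deriv p.xd) (Icc p.t₀ t) :=
    (p.xd_C2.continuous_deriv (by norm_num)).continuousOn
  have h2 : ContinuousOn (deriv (deriv p.xd)) (Icc p.t₀ t) := by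
    have : ContDiff ℝ 1 (deriv p.xd) := p.xd_C2.deriv'
    exact (this.continuous_deriv le_rfl).continuousOn
  have he : ContinuousOn (s.e p) (Icc p.t₀ t) := hx.sub h0
  have hed : ContinuousOn (s.edot p) (Icc p.t₀ t) := hv.sub h1
  have hr : ContinuousOn (s.r p) (Icc p.t₀ t) := hed.add (he.const_smul p.α₁)
  exact hf.add ((((h2.sub hΦ).sub (hr.const_smul p.k₁)).sub he).sub (hed.const_smul p.α₁))

theorem hasACDeriv_e (h : IsClosedLoop p s b δf) {t : ℝ} (ht : t ∈ span p.t₀ b) :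
    HasACDeriv (s.e p) (s.edot p) p.t₀ t :=
  (hasACDeriv_of_hasDerivWithinAt ht.1
    (fun τ hτ => (h.pos τ (Icc_subset_span ht hτ)).mono (Icc_subset_span ht))
    (h.continuousOn_v ht)).sub (hasACDeriv_of_contDiff (p.xd_C2.of_le (by norm_num)) _ _)

theorem hasACDeriv_r (h : IsClosedLoop p s b δf) {t : ℝ} (ht : t ∈ span p.t₀ b) :
    HasACDeriv (s.r p) (fun τ => s.acc p τ - deriv (deriv p.xd) τ + p.α₁ • s.edot p τ) p.t₀ t :=
  ((hasACDeriv_of_hasDerivWithinAt ht.1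
    (fun τ hτ => (h.vel τ (Icc_subset_span ht hτ)).mono (Icc_subset_span ht))
    (h.continuousOn_acc ht)).sub (hasACDeriv_of_contDiff p.xd_C2.deriv' _ _)).add
    ((h.hasACDeriv_e ht).const_smul p.α₁)

theorem continuousOn_norm_ζ (h : IsClosedLoop p s b δf) {t : ℝ} (ht : t ∈ span p.t₀ b) :
    ContinuousOn (fun τ => ‖s.ζ p τ‖) (Icc p.t₀ t) := by
  have hr := (h.hasACDeriv_r ht).continuousOn ht.1
  have he := (h.hasACDeriv_e ht).continuousOn ht.1
  have hθ := ((h.θ_law.hasACDeriv ht).const_sub p.θs).continuousOn ht.1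
  have heq : (fun τ => ‖s.ζ p τ‖) =
      fun τ => √(‖s.r p τ‖ ^ 2 + ‖s.e p τ‖ ^ 2 + ‖p.θs - s.θh τ‖ ^ 2) := by
    funext τ
    rw [← Signals.θt, ← Arch.norm_sq_err, Real.sqrt_sq (norm_nonneg _), Signals.ζ]
  rw [heq]
  exact ((hr.norm.pow 2).add (he.norm.pow 2) |>.add (hθ.norm.pow 2)).sqrt

/-! ### The observer -/

theorem Λ₁_pos (p : Problem A) : 0 < p.Λ₁ :=
  lt_min p.kΔ_pos (by linarith [p.α₂_pos])

theorem norm_sq_z (s : Signals A N) (p : Problem A) (t : ℝ) :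
    ‖s.z p t‖ ^ 2 = ‖s.rt p t‖ ^ 2 + ‖s.Δt p t‖ ^ 2 := by
  rw [Signals.z, WithLp.prod_norm_sq_eq_of_L2]
  rfl

/-- The error dynamics are r̃' = Δ̃ - α₂r̃ and Δ̃' = d/dt f - r̃ - k_Δ Δ̃. In the derivative of ‖z‖²
the cross terms cancel, and Young's inequality pays for d/dt f with half of the damping of Δ̃,
leaving the rate min {k_Δ, 2α₂}. -/
theorem norm_sq_z_le (h : IsClosedLoop p s b δf)
    {χ : ℝ} (hf : p.IsFdotBound χ δf) {t : ℝ} (ht : t ∈ span p.t₀ b)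
    (hD : ∀ τ ∈ Icc p.t₀ t, s.ζ p τ ∈ p.D χ) :
    ‖s.z p t‖ ^ 2 ≤ ‖s.z p p.t₀‖ ^ 2 * Real.exp (-p.Λ₁ * (t - p.t₀))
      + δf ^ 2 / p.kΔ / p.Λ₁ * (1 - Real.exp (-p.Λ₁ * (t - p.t₀))) := by
  have hsub := Icc_subset_span ht
  let F : ℝ → A.Vec := fun τ => fderiv ℝ p.f (s.X τ) (Arch.pair (s.v τ) (s.acc p τ))
  have hF : ∀ τ ∈ Icc p.t₀ t, ‖F τ‖ ≤ δf := fun τ hτ => by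
    have h1 := hf τ hτ.1 (s.r p τ) (s.e p τ) (s.θt p τ) (hD τ hτ)
    have h2 : s.r p τ - p.α₁ • s.e p τ + deriv p.xd τ = s.v τ := by
      simp [Signals.r, Signals.edot]
    have h3 : p.θs - s.θt p τ = s.θh τ := by simp [Signals.θt]
    rw [h2, h3, ← s.u_eq_ctrl, ← s.X_eq_inputOf] at h1
    exact h1
  have hxd : ∀ τ, HasDerivAt p.xd (deriv p.xd τ) τ := fun τ =>
    (p.xd_C2.differentiable (by norm_num)).differentiableAt.hasDerivAt
  have hxd' : ∀ τ, HasDerivAt (deriv p.xd) (deriv (deriv p.xd) τ) τ := fun τ =>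
    ((p.xd_C2.deriv' (n := 1)).differentiable (by norm_num)).differentiableAt.hasDerivAt
  have hr : ∀ τ ∈ Icc p.t₀ t, HasDerivWithinAt (s.rt p) (s.Δt p τ - p.α₂ • s.rt p τ)
      (Icc p.t₀ t) τ := fun τ hτ => by
    have hx := (h.pos τ (hsub hτ)).mono hsub
    have hv := (h.vel τ (hsub hτ)).mono hsub
    have h1 := ((hv.sub (hxd' τ).hasDerivWithinAt).add
      ((hx.sub (hxd τ).hasDerivWithinAt).const_smul p.α₁)).sub ((h.obs_r τ (hsub hτ)).mono hsub)
    refine h1.congr_deriv ?_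
    simp only [Signals.Δt, Signals.acc, Signals.edot]
    abel
  have hΔ : ∀ τ ∈ Icc p.t₀ t, HasDerivWithinAt (s.Δt p) (F τ - (s.rt p τ + p.kΔ • s.Δt p τ))
      (Icc p.t₀ t) τ := fun τ hτ => by
    have hx := (h.pos τ (hsub hτ)).mono hsub
    have hv := (h.vel τ (hsub hτ)).mono hsub
    have hX : HasDerivWithinAt s.X (Arch.pair (s.v τ) (s.acc p τ)) (Icc p.t₀ t) τ :=
      Arch.pairL.hasFDerivAt.comp_hasDerivWithinAt τ (hx.prodMk hv)
    have hfX : HasDerivWithinAt (fun τ => p.f (s.X τ)) (F τ) (Icc p.t₀ t) τ :=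
      ((p.f_C1.differentiable one_ne_zero).differentiableAt.hasFDerivAt).comp_hasDerivWithinAt τ hX
    -- Δ̃ = f(X) - (Δ̂ - u), so `u` itself is never differentiated.
    refine (hfX.sub ((h.obs_Δ τ (hsub hτ)).mono hsub)).congr_of_mem (fun σ _ => ?_) hτ
    simp only [Signals.Δt, Signals.acc, Pi.sub_apply]
    abel
  simp only [norm_sq_z]
  refine le_exp_of_hasDerivWithinAt_le (v := fun τ => ‖s.rt p τ‖ ^ 2 + ‖s.Δt p τ‖ ^ 2) ht.1
    (Λ₁_pos p) (fun τ hτ => (hr τ hτ).norm_sq.add (hΔ τ hτ).norm_sq) fun τ hτ => ?_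
  have hk := p.kΔ_pos
  have h1 : p.Λ₁ ≤ p.kΔ := min_le_left _ _
  have h2 : p.Λ₁ ≤ 2 * p.α₂ := min_le_right _ _
  have h3 : inner ℝ (s.Δt p τ) (F τ) ≤ ‖s.Δt p τ‖ * δf :=
    (real_inner_le_norm _ _).trans (mul_le_mul_of_nonneg_left (hF τ hτ) (norm_nonneg _))
  have h4 : 2 * (‖s.Δt p τ‖ * δf) ≤ p.kΔ * ‖s.Δt p τ‖ ^ 2 + δf ^ 2 / p.kΔ := by
    have : 0 ≤ (p.kΔ * ‖s.Δt p τ‖ - δf) ^ 2 / p.kΔ := by positivity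
    have e : (p.kΔ * ‖s.Δt p τ‖ - δf) ^ 2 / p.kΔ
      = p.kΔ * ‖s.Δt p τ‖ ^ 2 + δf ^ 2 / p.kΔ - 2 * (‖s.Δt p τ‖ * δf) := by
      field_simp
      ring
    linarith
  have h5 := real_inner_comm (s.rt p τ) (s.Δt p τ)
  simp only [inner_sub_right, inner_add_right, real_inner_smul_right, real_inner_self_eq_norm_sq]
  have h6 := mul_le_mul_of_nonneg_right h1 (sq_nonneg ‖s.Δt p τ‖)
  have h7 := mul_le_mul_of_nonneg_right h2 (sq_nonneg ‖s.rt p τ‖)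
  nlinarith

theorem norm_sq_z_le_const (h : IsClosedLoop p s b δf)
    {χ : ℝ} (hf : p.IsFdotBound χ δf) {t : ℝ} (ht : t ∈ span p.t₀ b)
    (hD : ∀ τ ∈ Icc p.t₀ t, s.ζ p τ ∈ p.D χ) :
    ‖s.z p t‖ ^ 2 ≤ ‖s.z p p.t₀‖ ^ 2 + δf ^ 2 / p.kΔ / p.Λ₁ := by
  have h1 := h.norm_sq_z_le hf ht hD
  have hΛ := Λ₁_pos p
  have hk := p.kΔ_pos
  have h2 : Real.exp (-p.Λ₁ * (t - p.t₀)) ≤ 1 :=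
    Real.exp_le_one_iff.2 (by nlinarith [ht.1])
  have h3 := Real.exp_pos (-p.Λ₁ * (t - p.t₀))
  have h4 : 0 ≤ δf ^ 2 / p.kΔ / p.Λ₁ := by positivity
  nlinarith [sq_nonneg ‖s.z p p.t₀‖]

/-- With q = δf²/(k_Δ Λ₁), the decay estimate reads ‖z‖² - q ≤ (‖z(t₀)‖² - q) exp(-Λ₁(t - t₀)). The
gain condition says q < δΔ², and otherwise the settling time solves for the right side being δΔ² -
q. -/
theorem norm_Δt_le (h : IsClosedLoop p s b δf)
    {χ : ℝ} (hf : p.IsFdotBound χ δf) (hgain : δf ^ 2 / p.δΔ ^ 2 < p.kΔ * p.Λ₁)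
    {t : ℝ} (ht : t ∈ span p.t₀ b) (hD : ∀ τ ∈ Icc p.t₀ t, s.ζ p τ ∈ p.D χ)
    (htΔ : s.tΔ p δf ≤ t) : ‖s.Δt p t‖ ≤ p.δΔ := by
  have hz := h.norm_sq_z_le hf ht hD
  have hΛ := Λ₁_pos p
  have hk := p.kΔ_pos
  have hδ := p.δΔ_pos
  have hkΛ : 0 < p.kΔ * p.Λ₁ := mul_pos hk hΛ
  set E := Real.exp (-p.Λ₁ * (t - p.t₀)) with hE
  have hE1 : E ≤ 1 := Real.exp_le_one_iff.2 (by nlinarith [ht.1])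
  have hE0 : 0 < E := Real.exp_pos _
  set q := δf ^ 2 / p.kΔ / p.Λ₁ with hq
  have hqe : q * (p.kΔ * p.Λ₁) = δf ^ 2 := by rw [hq]; field_simp
  have hqδ : q < p.δΔ ^ 2 := by
    rw [div_lt_iff₀ (by positivity)] at hgain
    have : q * (p.kΔ * p.Λ₁) < p.δΔ ^ 2 * (p.kΔ * p.Λ₁) := by rw [hqe]; linarith
    exact lt_of_mul_lt_mul_right this hkΛ.le
  have hz2 : ‖s.z p t‖ ^ 2 ≤ p.δΔ ^ 2 := by
    refine hz.trans ?_
    unfold Signals.tΔ at htΔ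
    split_ifs at htΔ with hz0
    · have : ‖s.z p p.t₀‖ ^ 2 ≤ p.δΔ ^ 2 := by gcongr
      nlinarith
    · have hz1 : p.δΔ ^ 2 < ‖s.z p p.t₀‖ ^ 2 := by
        have := not_le.1 hz0
        gcongr
      have hnum : 0 < ‖s.z p p.t₀‖ ^ 2 - q := by linarith
      have hden : 0 < p.δΔ ^ 2 - q := by linarith
      have hrat : (p.kΔ * p.Λ₁ * ‖s.z p p.t₀‖ ^ 2 - δf ^ 2) /
          (p.kΔ * p.Λ₁ * p.δΔ ^ 2 - δf ^ 2) =
          (‖s.z p p.t₀‖ ^ 2 - q) / (p.δΔ ^ 2 - q) := by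
        rw [← hqe, ← mul_div_mul_left (‖s.z p p.t₀‖ ^ 2 - q) _ hkΛ.ne']
        congr 1 <;> ring
      rw [hrat] at htΔ
      have hlog : Real.log ((‖s.z p p.t₀‖ ^ 2 - q) / (p.δΔ ^ 2 - q)) ≤ p.Λ₁ * (t - p.t₀) := by
        have h1 : 1 / p.Λ₁ * Real.log ((‖s.z p p.t₀‖ ^ 2 - q) / (p.δΔ ^ 2 - q)) ≤ t - p.t₀ := by
          linarith
        rw [div_mul_eq_mul_div, one_mul, div_le_iff₀ hΛ] at h1
        linarith
      have h2 : (‖s.z p p.t₀‖ ^ 2 - q) / (p.δΔ ^ 2 - q) ≤ Real.exp (p.Λ₁ * (t - p.t₀)) :=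
        (Real.log_le_iff_le_exp (div_pos hnum hden)).1 hlog
      have h3 : E * Real.exp (p.Λ₁ * (t - p.t₀)) = 1 := by
        rw [hE, ← Real.exp_add]; simp
      rw [div_le_iff₀ hden] at h2
      have h4 := mul_le_mul_of_nonneg_left h2 hE0.le
      rw [← mul_assoc, h3] at h4
      linarith
  have h5 := norm_sq_z s p t
  exact abs_le_of_sq_le_sq' (by nlinarith [sq_nonneg ‖s.rt p t‖]) hδ.le |>.2

end IsClosedLoop

/-! ### Lyapunov analysis -/

namespace Problem

variable {A : Arch} (p : Problem A)

theorem lΓmax_pos : 0 < p.lΓmax := p.lΓmin_pos.trans_le p.lΓ_le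

theorem β₁_pos : 0 < p.β₁ := by
  have := p.lΓmax_pos
  exact lt_min (by norm_num) (by positivity)

theorem β₁_le_β₂ : p.β₁ ≤ p.β₂ := (min_le_left _ _).trans (le_max_left _ _)

theorem β₂_pos : 0 < p.β₂ := p.β₁_pos.trans_le p.β₁_le_β₂

theorem norm_θs_le : ‖p.θs‖ ≤ p.θB :=
  le_csSup (p.P_compact.image continuous_norm).bddAbove (mem_image_of_mem _ p.θs_mem)

theorem inner_JT (X : A.Inp) (θ w : A.Par) (y : A.Vec) :
    inner ℝ w (p.JT X θ y) = inner ℝ (p.J X θ w) y :=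
  ContinuousLinearMap.adjoint_inner_right _ _ _

end Problem

namespace Signals

variable {A : Arch} {N : ℕ} (s : Signals A N) (p : Problem A)

/-- The Lyapunov function `½ ‖r‖² + ½ ‖e‖² + ½ θ̃ᵀ Γ⁻¹ θ̃`. -/
noncomputable def lyap (t : ℝ) : ℝ :=
  1 / 2 * inner ℝ (s.r p t) (s.r p t) + 1 / 2 * inner ℝ (s.e p t) (s.e p t)
    + 1 / 2 * inner ℝ (s.θt p t) (s.Γinv t (s.θt p t))

theorem norm_sq_ζ (t : ℝ) :
    ‖s.ζ p t‖ ^ 2 = ‖s.r p t‖ ^ 2 + ‖s.e p t‖ ^ 2 + ‖s.θt p t‖ ^ 2 :=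
  Arch.norm_sq_err _ _ _

theorem ι₄_nonneg (ρ₁ ρ₅ : ℝ → ℝ) (εB : ℝ) : 0 ≤ s.ι₄ p ρ₁ ρ₅ εB := by
  have h1 := p.γ₁_pos
  have h2 := p.γ₂_pos
  have h3 := p.δΔ_pos
  unfold ι₄
  positivity

theorem X_mem_Ω {t χ : ℝ} (ht : p.t₀ ≤ t) (hζ : s.ζ p t ∈ p.D χ) : s.X t ∈ p.Ω χ := by
  have h1 := p.norm_inputOf_le ht (s.r p t) (s.e p t) (s.θt p t)
  rw [← X_eq_inputOf] at h1
  have h2 : ‖Arch.err (s.r p t) (s.e p t) (s.θt p t)‖ ≤ χ := hζ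
  have h3 := mul_le_mul_of_nonneg_left h2 (by linarith [p.α₁_pos] : 0 ≤ p.α₁ + 2)
  change ‖s.X t‖ ≤ _
  linarith

/-- The filtered error dynamics in terms of the approximation error and the Taylor remainder. -/
theorem rdot_eq (t : ℝ) :
    s.acc p t - deriv (deriv p.xd) t + p.α₁ • s.edot p t =
      p.appErr (s.X t) + p.rem (s.X t) (s.θh t) p.θs + p.J (s.X t) (s.θh t) (s.θt p t)
        - p.k₁ • s.r p t - s.e p t := by
  simp only [acc, u, Problem.appErr, Problem.rem, θt]
  abel

/-- The recorded data in terms of the parameter error. -/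
theorem data_eq (t τ : ℝ) :
    s.u p τ - s.Δh τ + p.J (s.X τ) (s.θh t) (s.θh t) =
      s.Δt p τ - (p.appErr (s.X τ) - p.rem (s.X τ) (s.θh t) 0)
        - p.J (s.X τ) (s.θh t) (s.θt p t) - p.rem (s.X τ) (s.θh t) p.θs := by
  simp only [Δt, acc, Problem.appErr, Problem.rem, θt, p.Φ_zero, map_sub, map_zero]
  abel

variable {s p}

theorem inner_data_le {ρ₁ ρ₂ ρ₃ ρ₅ : ℝ → ℝ} (hb : p.IsBounding ρ₁ ρ₂ ρ₃ ρ₅) {t τ : ℝ}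
    (hτ : p.t₀ ≤ τ) (hθ : s.θh t ∈ p.Θε) (hΔ : ‖s.Δt p τ‖ ≤ p.δΔ) :
    inner ℝ (s.θt p t) (p.JT (s.X τ) (s.θh t)
      (s.u p τ - s.Δh τ + p.J (s.X τ) (s.θh t) (s.θh t))) ≤
    -inner ℝ (p.J (s.X τ) (s.θh t) (s.θt p t)) (p.J (s.X τ) (s.θh t) (s.θt p t))
      + (p.δΔ / 2 + 1) * ‖s.θt p t‖ ^ 2 + p.δΔ / 2 * ρ₁ ‖s.X τ‖ ^ 2
      + 1 / 2 * ρ₅ ‖s.X τ‖ ^ 2 + 1 / 2 * (ρ₃ ‖s.ζ p τ‖ ^ 2 * ‖s.ζ p t‖ ^ 2 * ‖s.ζ p t‖ ^ 2) := by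
  have hw : p.θs - s.θt p t = s.θh t := by simp [θt]
  have hδ := p.δΔ_pos
  rw [data_eq, map_sub, map_sub, map_sub, inner_sub_right, inner_sub_right, inner_sub_right,
    p.inner_JT _ _ _ (s.Δt p τ), p.inner_JT _ _ _ (p.J _ _ _)]
  set W := ‖s.θt p t‖ with hW
  have hW0 : 0 ≤ W := norm_nonneg _
  have h1 : inner ℝ (p.J (s.X τ) (s.θh t) (s.θt p t)) (s.Δt p τ) ≤ ρ₁ ‖s.X τ‖ * W * p.δΔ := by
    refine (real_inner_le_norm _ _).trans (mul_le_mul ?_ hΔ (norm_nonneg _) ?_)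
    · exact (ContinuousLinearMap.le_opNorm _ _).trans
        (mul_le_mul_of_nonneg_right (hb.jac _ _ hθ) hW0)
    · exact mul_nonneg (hb.incr₁.2 _ (norm_nonneg _)) hW0
  have h2 : -inner ℝ (s.θt p t) (p.JT (s.X τ) (s.θh t)
      (p.appErr (s.X τ) - p.rem (s.X τ) (s.θh t) 0)) ≤ W * ρ₅ ‖s.X τ‖ := by
    refine (neg_le_abs _).trans ((abs_real_inner_le_norm _ _).trans ?_)
    exact mul_le_mul_of_nonneg_left (hb.zero _ _ hθ) hW0
  have h3 : -inner ℝ (s.θt p t) (p.JT (s.X τ) (s.θh t) (p.rem (s.X τ) (s.θh t) p.θs)) ≤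
      W * (ρ₃ ‖s.ζ p τ‖ * ‖s.ζ p t‖ ^ 2) := by
    refine (neg_le_abs _).trans ((abs_real_inner_le_norm _ _).trans ?_)
    have h4 := hb.hist τ hτ (s.r p τ) (s.e p τ) (s.θt p τ) (s.r p t) (s.e p t) (s.θt p t)
      (by rw [hw]; exact hθ)
    rw [hw, ← s.X_eq_inputOf] at h4
    exact mul_le_mul_of_nonneg_left h4 hW0
  -- Young's inequality three times. The observer error costs δΔ/2 and the other two terms ½ each as
  -- coefficients of ‖θ̃‖²; these are the losses γ₁NδΔ/2 + γ₁N in λ₃.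
  have y1 : ρ₁ ‖s.X τ‖ * W * p.δΔ ≤ p.δΔ / 2 * W ^ 2 + p.δΔ / 2 * ρ₁ ‖s.X τ‖ ^ 2 := by
    nlinarith [mul_nonneg hδ.le (sq_nonneg (W - ρ₁ ‖s.X τ‖))]
  have y2 : W * ρ₅ ‖s.X τ‖ ≤ 1 / 2 * W ^ 2 + 1 / 2 * ρ₅ ‖s.X τ‖ ^ 2 := by
    nlinarith [sq_nonneg (W - ρ₅ ‖s.X τ‖)]
  have y3 : W * (ρ₃ ‖s.ζ p τ‖ * ‖s.ζ p t‖ ^ 2) ≤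
      1 / 2 * W ^ 2 + 1 / 2 * (ρ₃ ‖s.ζ p τ‖ ^ 2 * ‖s.ζ p t‖ ^ 2 * ‖s.ζ p t‖ ^ 2) := by
    nlinarith [sq_nonneg (W - ρ₃ ‖s.ζ p τ‖ * ‖s.ζ p t‖ ^ 2)]
  linarith

theorem inner_sum_data_le {ρ₁ ρ₂ ρ₃ ρ₅ : ℝ → ℝ} (hb : p.IsBounding ρ₁ ρ₂ ρ₃ ρ₅) {t : ℝ}
    (hτ : ∀ i, p.t₀ ≤ s.ts i) (hθ : s.θh t ∈ p.Θε)
    (hΔ : ∀ i ∈ s.stack t, ‖s.Δt p (s.ts i)‖ ≤ p.δΔ) :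
    inner ℝ (s.θt p t) (∑ i ∈ s.stack t, p.JT (s.X (s.ts i)) (s.θh t)
      (s.u p (s.ts i) - s.Δh (s.ts i) + p.J (s.X (s.ts i)) (s.θh t) (s.θh t))) ≤
    -inner ℝ (s.gram p t (s.θt p t)) (s.θt p t)
      + N * (p.δΔ / 2 + 1) * ‖s.θt p t‖ ^ 2 + N * p.δΔ / 2 * ∑ i, ρ₁ ‖s.X (s.ts i)‖ ^ 2
      + 1 / 2 * ∑ i, ρ₅ ‖s.X (s.ts i)‖ ^ 2
      + 1 / 2 * ((∑ i, ρ₃ ‖s.ζ p (s.ts i)‖ ^ 2 * ‖s.ζ p t‖ ^ 2) * ‖s.ζ p t‖ ^ 2) := by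
  have hδ := p.δΔ_pos
  rw [inner_sum, inner_gram]
  refine (Finset.sum_le_sum fun i hi => inner_data_le hb (hτ i) hθ (hΔ i hi)).trans ?_
  simp only [Finset.sum_add_distrib, Finset.sum_neg_distrib, Finset.sum_const, nsmul_eq_mul,
    ← Finset.mul_sum, ← Finset.sum_mul]
  have hcard : ((s.stack t).card : ℝ) ≤ N := by
    exact_mod_cast (Finset.card_le_univ _).trans_eq (Fintype.card_fin N)
  have hsub : ∀ g : Fin N → ℝ, (∀ i, 0 ≤ g i) → ∑ i ∈ s.stack t, g i ≤ ∑ i, g i := fun g hg =>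
    Finset.sum_le_sum_of_subset_of_nonneg (Finset.subset_univ _) fun i _ _ => hg i
  -- The sum of the estimates does not need this factor N; it is inserted to match ι₄. For N = 0
  -- both sides vanish.
  have hN : ∑ i, ρ₁ ‖s.X (s.ts i)‖ ^ 2 ≤ N * ∑ i, ρ₁ ‖s.X (s.ts i)‖ ^ 2 := by
    rcases Nat.eq_zero_or_pos N with rfl | hpos
    · simp
    · refine le_mul_of_one_le_left (Finset.sum_nonneg fun i _ => sq_nonneg _) ?_
      exact_mod_cast hpos
  have b1 := mul_le_mul_of_nonneg_right hcard
    (by positivity : 0 ≤ (p.δΔ / 2 + 1) * ‖s.θt p t‖ ^ 2)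
  have b2 := mul_le_mul_of_nonneg_left
    ((hsub (fun i => ρ₁ ‖s.X (s.ts i)‖ ^ 2) fun i => sq_nonneg _).trans hN)
    (by positivity : 0 ≤ p.δΔ / 2)
  have b3 := hsub (fun i => ρ₅ ‖s.X (s.ts i)‖ ^ 2) fun i => sq_nonneg _
  have b4 := mul_le_mul_of_nonneg_right
    (mul_le_mul_of_nonneg_right (hsub (fun i => ρ₃ ‖s.ζ p (s.ts i)‖ ^ 2) fun i => sq_nonneg _)
      (sq_nonneg ‖s.ζ p t‖)) (sq_nonneg ‖s.ζ p t‖)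
  linarith

end Signals

namespace IsClosedLoop

variable {A : Arch} {N : ℕ} {p : Problem A} {s : Signals A N} {b : EReal} {δf : ℝ}

theorem lyap_bounds (h : IsClosedLoop p s b δf) {t : ℝ} (ht : t ∈ span p.t₀ b) :
    p.β₁ * ‖s.ζ p t‖ ^ 2 ≤ s.lyap p t ∧ s.lyap p t ≤ p.β₂ * ‖s.ζ p t‖ ^ 2 := by
  obtain ⟨h1, h2⟩ := h.Γinv_bounds ht (s.θt p t)
  rw [real_inner_comm] at h1 h2
  have a1 : p.β₁ ≤ 1 / 2 := min_le_left _ _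
  have a2 : p.β₁ ≤ 1 / 2 * (1 / p.lΓmax) := min_le_right _ _
  have c1 : 1 / 2 ≤ p.β₂ := le_max_left _ _
  have c2 : 1 / 2 * (1 / p.lΓmin) ≤ p.β₂ := le_max_right _ _
  rw [s.norm_sq_ζ, Signals.lyap, real_inner_self_eq_norm_sq, real_inner_self_eq_norm_sq]
  have r0 := sq_nonneg ‖s.r p t‖
  have e0 := sq_nonneg ‖s.e p t‖
  have w0 := sq_nonneg ‖s.θt p t‖
  constructor
  · linarith [mul_le_mul_of_nonneg_right a1 r0, mul_le_mul_of_nonneg_right a1 e0,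
      mul_le_mul_of_nonneg_right a2 w0]
  · linarith [mul_le_mul_of_nonneg_right c1 r0, mul_le_mul_of_nonneg_right c1 e0,
      mul_le_mul_of_nonneg_right c2 w0]

theorem hasACDeriv_lyap (h : IsClosedLoop p s b δf) {t : ℝ} (ht : t ∈ span p.t₀ b) :
    HasACDeriv (s.lyap p) (fun τ =>
      inner ℝ (s.r p τ) (s.acc p τ - deriv (deriv p.xd) τ + p.α₁ • s.edot p τ)
      + inner ℝ (s.e p τ) (s.edot p τ) + 1 / 2 * inner ℝ (s.Γrhs p τ (s.θt p τ)) (s.θt p τ)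
      - inner ℝ (s.θt p τ) (s.Γinv τ (s.θrhs p τ))) p.t₀ t := by
  have hr := h.hasACDeriv_r ht
  have he := h.hasACDeriv_e ht
  have hθ : HasACDeriv (s.θt p) (fun τ => -s.θrhs p τ) p.t₀ t :=
    (h.θ_law.hasACDeriv ht).const_sub p.θs
  have hΓ := (h.Γ_law.hasACDeriv ht).clm_apply ht.1 hθ
  have hV := (((hr.inner ht.1 hr).const_smul (1 / 2)).add
    ((he.inner ht.1 he).const_smul (1 / 2))).add ((hθ.inner ht.1 hΓ).const_smul (1 / 2))
  refine HasACDeriv.congr_deriv (y := s.lyap p) hV fun τ hτ => ?_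
  have hτ' := span_of_le ht hτ.1.le hτ.2.le
  -- Symmetry of Γ⁻¹ merges the two terms containing the derivative of θ̃ into one.
  have e1 := h.Γinv_symm hτ' (s.θrhs p τ) (s.θt p τ)
  have e2 := real_inner_comm (s.θt p τ) (s.Γinv τ (s.θrhs p τ))
  have e3 := real_inner_comm (s.θt p τ) (s.Γrhs p τ (s.θt p τ))
  have e4 := real_inner_comm (s.r p τ)
    (s.acc p τ - deriv (deriv p.xd) τ + p.α₁ • s.edot p τ)
  have e5 := real_inner_comm (s.e p τ) (s.edot p τ)
  rw [inner_add_right (s.θt p τ) (s.Γrhs p τ (s.θt p τ)), map_neg, inner_neg_right,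
    inner_neg_left]
  simp only [smul_eq_mul]
  linarith

/-- Forgetting only lowers the form because Γ⁻¹ is positive, and the frozen branch gives 0, which
the nonnegative Gram form dominates. Both branches thus share one bound. -/
theorem inner_Γrhs_le (h : IsClosedLoop p s b δf) {t : ℝ} (ht : t ∈ span p.t₀ b) (w : A.Par) :
    inner ℝ (s.Γrhs p t w) w ≤ p.γ₁ * inner ℝ (s.gram p t w) w := by
  have hg : 0 ≤ inner ℝ (s.gram p t w) w := by
    rw [s.inner_gram]
    exact Finset.sum_nonneg fun i _ => real_inner_self_nonneg
  unfold Signals.Γrhs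
  split_ifs
  · have h1 : 0 ≤ inner ℝ (s.Γinv t w) w := by
      have := p.lΓmax_pos
      exact le_trans (by positivity) (h.Γinv_bounds ht w).1
    have h2 := mul_nonneg (p.β_nonneg t) h1
    simp only [add_apply, neg_apply, smul_apply, inner_add_left, inner_neg_left,
      real_inner_smul_left]
    linarith
  · simpa using mul_nonneg p.γ₁_pos.le hg

theorem lyap_deriv_le (h : IsClosedLoop p s b δf) {ρ₁ ρ₂ ρ₃ ρ₅ ρδ : ℝ → ℝ} {εB lam_e lam₃d χ₄ t : ℝ}
    (hb : p.IsBounding ρ₁ ρ₂ ρ₃ ρ₅) (hρδ : Problem.IncrNonneg ρδ)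
    (hδ : ∀ a : ℝ, 0 ≤ a → 1 / 2 * ρ₂ a ^ 2 * a ^ 2
        + p.γ₁ / 2 * ∑ i, ρ₃ ‖s.ζ p (s.ts i)‖ ^ 2 * a ^ 2 ≤ ρδ a)
    (hχ : ρδ χ₄ = p.lam₃ N lam_e - lam₃d)
    (hε : ∀ X ∈ p.Ω χ₄, ‖p.appErr X‖ ≤ εB) (h3d : 0 < lam₃d) (ht : t ∈ span p.t₀ b)
    (hexc : lam_e ≤ lamMin (s.gram p t)) (hD : s.ζ p t ∈ p.D χ₄)
    (hΔ : ∀ i ∈ s.stack t, ‖s.Δt p (s.ts i)‖ ≤ p.δΔ) :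
    inner ℝ (s.r p t) (s.acc p t - deriv (deriv p.xd) t + p.α₁ • s.edot p t)
      + inner ℝ (s.e p t) (s.edot p t) + 1 / 2 * inner ℝ (s.Γrhs p t (s.θt p t)) (s.θt p t)
      - inner ℝ (s.θt p t) (s.Γinv t (s.θrhs p t)) ≤
    -(lam₃d / p.β₂) * s.lyap p t + s.ι₄ p ρ₁ ρ₅ εB := by
  have hθ := h.θh_mem ht
  have hγ₁ := p.γ₁_pos
  have hγ₂ := p.γ₂_pos
  have hproj : inner ℝ (s.θt p t) (s.Γinv t (s.rawLaw p t)) ≤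
      inner ℝ (s.θt p t) (s.Γinv t (s.θrhs p t)) := by
    refine inner_inv_le_inner_inv_proj p.P_convex p.εP_pos
      (p.P_C1.differentiable one_ne_zero).differentiableAt (h.Γinv_Γ ht) ?_ p.θs_mem _
    by_cases h0 : gradient p.P (s.θh t) = 0
    · simp [h0]
    · exact (h.inner_Γ_pos ht h0).le
  rw [Signals.rawLaw, h.Γinv_Γ ht, inner_sub_right, inner_sub_right, real_inner_smul_right,
    real_inner_smul_right, p.inner_JT] at hproj
  have hsum := mul_le_mul_of_nonneg_left
    (Signals.inner_sum_data_le hb (fun i => (h.rec_mem i).1) hθ hΔ) hγ₁.le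
  have hΓ := h.inner_Γrhs_le ht (s.θt p t)
  have hgram : lam_e * ‖s.θt p t‖ ^ 2 ≤ inner ℝ (s.gram p t (s.θt p t)) (s.θt p t) :=
    (mul_le_mul_of_nonneg_right hexc (sq_nonneg _)).trans
      (lamMin_mul_le_inner (s.isSelfAdjoint_gram p t) _)
  have hgram' := mul_le_mul_of_nonneg_left hgram hγ₁.le
  -- The leakage term: with θ̂ = θ* - θ̃ it yields the damping γ₂/2 and the residual γ₂θ̄²/2.
  have hθθ : inner ℝ (s.θt p t) (s.θh t) ≤ -(1 / 2) * ‖s.θt p t‖ ^ 2 + 1 / 2 * p.θB ^ 2 := by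
    have e1 : s.θh t = p.θs - s.θt p t := by simp [Signals.θt]
    have e2 : ‖p.θs‖ ^ 2 ≤ p.θB ^ 2 := by gcongr; exact p.norm_θs_le
    have e3 := real_inner_le_norm (s.θt p t) p.θs
    rw [e1, inner_sub_right, real_inner_self_eq_norm_sq]
    nlinarith [sq_nonneg (‖s.θt p t‖ - ‖p.θs‖)]
  have hθθ' := mul_le_mul_of_nonneg_left hθθ hγ₂.le
  -- This and the next estimate cost ½‖r‖² each, whence k₁ - 1 in λ₃.
  have hεr : inner ℝ (s.r p t) (p.appErr (s.X t)) ≤ 1 / 2 * ‖s.r p t‖ ^ 2 + 1 / 2 * εB ^ 2 := by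
    have e1 := hε _ (s.X_mem_Ω p ht.1 hD)
    have e2 := real_inner_le_norm (s.r p t) (p.appErr (s.X t))
    have e3 : ‖p.appErr (s.X t)‖ ^ 2 ≤ εB ^ 2 := by gcongr
    nlinarith [sq_nonneg (‖s.r p t‖ - ‖p.appErr (s.X t)‖)]
  have hRr : inner ℝ (s.r p t) (p.rem (s.X t) (s.θh t) p.θs) ≤ 1 / 2 * ‖s.r p t‖ ^ 2
      + 1 / 2 * ρ₂ ‖s.ζ p t‖ ^ 2 * ‖s.ζ p t‖ ^ 2 * ‖s.ζ p t‖ ^ 2 := by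
    have hw : p.θs - s.θt p t = s.θh t := by simp [Signals.θt]
    have e1 := hb.cur t ht.1 (s.r p t) (s.e p t) (s.θt p t) (by rw [hw]; exact hθ)
    rw [hw, ← s.X_eq_inputOf] at e1
    change _ ≤ ρ₂ ‖s.ζ p t‖ * ‖s.ζ p t‖ ^ 2 at e1
    have e2 := real_inner_le_norm (s.r p t) (p.rem (s.X t) (s.θh t) p.θs)
    have e3 := mul_le_mul_of_nonneg_left e1 (norm_nonneg (s.r p t))
    nlinarith [sq_nonneg (‖s.r p t‖ - ρ₂ ‖s.ζ p t‖ * ‖s.ζ p t‖ ^ 2)]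
  have hed : s.edot p t = s.r p t - p.α₁ • s.e p t := by simp [Signals.r]
  have hre := real_inner_comm (s.e p t) (s.r p t)
  have hrJ := real_inner_comm (s.r p t) (p.J (s.X t) (s.θh t) (s.θt p t))
  have hD' : ‖s.ζ p t‖ ≤ χ₄ := hD
  have hρ : ρδ ‖s.ζ p t‖ ≤ p.lam₃ N lam_e - lam₃d := hχ ▸ hρδ.le (norm_nonneg _) hD'
  -- All Taylor remainder terms together are at most ρδ(‖ζ‖)‖ζ‖² ≤ (λ₃ - λ₃d)‖ζ‖² in the ball, so
  -- the rate λ₃d survives.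
  have hρ2 := mul_le_mul_of_nonneg_right ((hδ _ (norm_nonneg (s.ζ p t))).trans hρ)
    (sq_nonneg ‖s.ζ p t‖)
  have l1 : p.lam₃ N lam_e ≤ p.k₁ - 1 := min_le_left _ _
  have l2 : p.lam₃ N lam_e ≤ p.α₁ := (min_le_right _ _).trans (min_le_left _ _)
  have l3 : p.lam₃ N lam_e ≤ p.γ₁ / 2 * lam_e + p.γ₂ / 2 - p.γ₁ * N * p.δΔ / 2 - p.γ₁ * N :=
    (min_le_right _ _).trans (min_le_right _ _)
  have m1 := mul_le_mul_of_nonneg_right l1 (sq_nonneg ‖s.r p t‖)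
  have m2 := mul_le_mul_of_nonneg_right l2 (sq_nonneg ‖s.e p t‖)
  have m3 := mul_le_mul_of_nonneg_right l3 (sq_nonneg ‖s.θt p t‖)
  have hlam : p.lam₃ N lam_e * ‖s.ζ p t‖ ^ 2 = p.lam₃ N lam_e * ‖s.r p t‖ ^ 2
      + p.lam₃ N lam_e * ‖s.e p t‖ ^ 2 + p.lam₃ N lam_e * ‖s.θt p t‖ ^ 2 := by
    rw [s.norm_sq_ζ]; ring
  have hV : lam₃d / p.β₂ * s.lyap p t ≤ lam₃d * ‖s.ζ p t‖ ^ 2 := by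
    have e1 := mul_le_mul_of_nonneg_left (h.lyap_bounds ht).2 (div_pos h3d p.β₂_pos).le
    have e2 : lam₃d / p.β₂ * (p.β₂ * ‖s.ζ p t‖ ^ 2) = lam₃d * ‖s.ζ p t‖ ^ 2 := by
      have := p.β₂_pos.ne'
      field_simp
    linarith
  rw [s.rdot_eq, hed]
  simp only [inner_sub_right, inner_add_right, real_inner_smul_right, real_inner_self_eq_norm_sq]
  unfold Signals.ι₄
  linarith

end IsClosedLoop

/-! ### The exponential envelope and the boundedness of all signals. -/

namespace Signals

/-- In the set of stabilizing initial conditions the envelope lies inside the ball. -/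
theorem envelope_lt {A : Arch} {N : ℕ} {p : Problem A} {s : Signals A N}
    {ρ₁ ρ₅ : ℝ → ℝ} {εB lam₃d χ₄ T t : ℝ} (h3d : 0 < lam₃d) (hTt : T ≤ t)
    (hH : s.ζ p T ∈ s.H p ρ₁ ρ₅ εB χ₄ lam₃d) :
    p.β₂ / p.β₁ * ‖s.ζ p T‖ ^ 2 * Real.exp (-(lam₃d / p.β₂) * (t - T))
      + p.β₂ * s.ι₄ p ρ₁ ρ₅ εB / (p.β₁ * lam₃d)
        * (1 - Real.exp (-(lam₃d / p.β₂) * (t - T))) < χ₄ ^ 2 := by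
  have hβ₁ := p.β₁_pos
  have hβ₂ := p.β₂_pos
  have hι := s.ι₄_nonneg p ρ₁ ρ₅ εB
  have h1 : ‖s.ζ p T‖ ^ 2 < p.β₁ / p.β₂ * χ₄ ^ 2 - s.ι₄ p ρ₁ ρ₅ εB / lam₃d :=
    (Real.lt_sqrt (norm_nonneg _)).1 hH
  have h2 := mul_lt_mul_of_pos_left h1 (div_pos hβ₂ hβ₁)
  have e : p.β₂ / p.β₁ * (p.β₁ / p.β₂ * χ₄ ^ 2 - s.ι₄ p ρ₁ ρ₅ εB / lam₃d) =
      χ₄ ^ 2 - p.β₂ * s.ι₄ p ρ₁ ρ₅ εB / (p.β₁ * lam₃d) := by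
    field_simp
  rw [e] at h2
  set E := Real.exp (-(lam₃d / p.β₂) * (t - T))
  have hE : 0 < E := Real.exp_pos _
  have hE1 : E ≤ 1 := Real.exp_le_one_iff.2
    (by nlinarith [mul_nonneg (div_pos h3d hβ₂).le (sub_nonneg.2 hTt)])
  -- The envelope is a E + b (1 - E) with a, b ≥ 0 and 0 < E ≤ 1, hence at most a + b, which is
  -- below χ₄² by `h2`.
  have h3 : 0 ≤ p.β₂ * s.ι₄ p ρ₁ ρ₅ εB / (p.β₁ * lam₃d) := by positivity
  have h4 : 0 ≤ p.β₂ / p.β₁ * ‖s.ζ p T‖ ^ 2 := by positivity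
  nlinarith

end Signals

namespace IsClosedLoop

variable {A : Arch} {N : ℕ} {p : Problem A} {s : Signals A N} {b : EReal} {δf : ℝ}

/-- The exponential envelope, as long as the errors have stayed in the ball of radius `χ₄`. -/
theorem norm_sq_ζ_le (h : IsClosedLoop p s b δf)
    {ρ₁ ρ₂ ρ₃ ρ₅ ρδ : ℝ → ℝ} {εB lam_e lam₃d χ₄ T t : ℝ}
    (hb : p.IsBounding ρ₁ ρ₂ ρ₃ ρ₅) (hρδ : Problem.IncrNonneg ρδ)
    (hδ : ∀ a : ℝ, 0 ≤ a → 1 / 2 * ρ₂ a ^ 2 * a ^ 2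
        + p.γ₁ / 2 * ∑ i, ρ₃ ‖s.ζ p (s.ts i)‖ ^ 2 * a ^ 2 ≤ ρδ a)
    (hχ : ρδ χ₄ = p.lam₃ N lam_e - lam₃d)
    (hε : ∀ X ∈ p.Ω χ₄, ‖p.appErr X‖ ≤ εB) (hf : p.IsFdotBound χ₄ δf)
    (hgain : δf ^ 2 / p.δΔ ^ 2 < p.kΔ * p.Λ₁) (h3d : 0 < lam₃d)
    (hT : p.t₀ ≤ T) (hTt : T ≤ t) (ht : t ∈ span p.t₀ b)
    (hexc : ∀ τ ∈ span p.t₀ b, T ≤ τ → lam_e ≤ lamMin (s.gram p τ))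
    (hD : ∀ τ ∈ Icc p.t₀ t, s.ζ p τ ∈ p.D χ₄) :
    ‖s.ζ p t‖ ^ 2 ≤ p.β₂ / p.β₁ * ‖s.ζ p T‖ ^ 2 * Real.exp (-(lam₃d / p.β₂) * (t - T))
      + p.β₂ * s.ι₄ p ρ₁ ρ₅ εB / (p.β₁ * lam₃d)
        * (1 - Real.exp (-(lam₃d / p.β₂) * (t - T))) := by
  have hβ₁ := p.β₁_pos
  have hβ₂ := p.β₂_pos
  have hV := ((h.hasACDeriv_lyap ht).mono hT hTt le_rfl).le_exp_of_le hTt (div_pos h3d hβ₂)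
    (fun τ hτ => by
      have hτ0 : p.t₀ ≤ τ := hT.trans hτ.1.le
      have hτs := span_of_le ht hτ0 hτ.2.le
      refine h.lyap_deriv_le hb hρδ hδ hχ hε h3d hτs (hexc τ hτs hτ.1.le) (hD τ ⟨hτ0, hτ.2.le⟩)
        fun i hi => ?_
      have hi' : s.ts i ≤ τ := (Finset.mem_filter.1 hi).2
      -- Observer accuracy at a recording time uses only the history up to that time, which precedes
      -- τ and so lies in the ball.
      exact h.norm_Δt_le hf hgain (h.rec_mem i)
        (fun σ hσ => hD σ ⟨hσ.1, hσ.2.trans (hi'.trans hτ.2.le)⟩) (h.rec_late i))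
  have h1 := (h.lyap_bounds ht).1
  have h2 := (h.lyap_bounds (span_of_le ht hT hTt)).2
  set E := Real.exp (-(lam₃d / p.β₂) * (t - T))
  have hE : 0 < E := Real.exp_pos _
  have h3 := mul_le_mul_of_nonneg_right h2 hE.le
  have h4 : p.β₁ * ‖s.ζ p t‖ ^ 2 ≤ p.β₁ * (p.β₂ / p.β₁ * ‖s.ζ p T‖ ^ 2 * E
      + p.β₂ * s.ι₄ p ρ₁ ρ₅ εB / (p.β₁ * lam₃d) * (1 - E)) := by
    have e : p.β₁ * (p.β₂ / p.β₁ * ‖s.ζ p T‖ ^ 2 * E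
      + p.β₂ * s.ι₄ p ρ₁ ρ₅ εB / (p.β₁ * lam₃d) * (1 - E)) =
      p.β₂ * ‖s.ζ p T‖ ^ 2 * E + s.ι₄ p ρ₁ ρ₅ εB / (lam₃d / p.β₂) * (1 - E) := by
      field_simp
    rw [e]
    linarith
  exact le_of_mul_le_mul_left h4 hβ₁

/-- The inputs and the estimate stay in compact sets, which bounds Φ and f and hence u. The observer
states then differ from bounded signals by components of z. -/
theorem exists_bound (h : IsClosedLoop p s b δf) {χ : ℝ} (hf : p.IsFdotBound χ δf)
    (hD : ∀ t ∈ span p.t₀ b, s.ζ p t ∈ p.D χ) :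
    ∃ C : ℝ, ∀ t ∈ span p.t₀ b,
      ‖s.e p t‖ ≤ C ∧ ‖s.r p t‖ ≤ C ∧ ‖s.θt p t‖ ≤ C ∧ ‖s.x t‖ ≤ C ∧ ‖s.v t‖ ≤ C ∧
      ‖s.θh t‖ ≤ C ∧ ‖s.u p t‖ ≤ C ∧ ‖s.z p t‖ ≤ C ∧ ‖s.rh t‖ ≤ C ∧ ‖s.Δh t‖ ≤ C ∧
      ‖s.Γ t‖ ≤ C ∧ ‖s.Γinv t‖ ≤ C := by
  have hα := p.α₁_pos
  have hk := p.k₁_pos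
  set RX := (p.α₁ + 2) * χ + p.xdB + p.xdB' with hRX
  obtain ⟨CΦ, hCΦ⟩ := ((isCompact_closedBall (0 : A.Inp) RX).prod
    p.isCompact_Θε).exists_bound_of_continuousOn p.continuous_Φ.continuousOn
  obtain ⟨Cf, hCf⟩ := (isCompact_closedBall (0 : A.Inp) RX).exists_bound_of_continuousOn
    p.f_C1.continuous.continuousOn
  obtain ⟨Cθ, hCθ⟩ := p.isCompact_Θε.isBounded.exists_norm_le
  set Cz := √(‖s.z p p.t₀‖ ^ 2 + δf ^ 2 / p.kΔ / p.Λ₁) with hCz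
  set Cv := χ + p.α₁ * χ + p.xdB' with hCv
  set Cu := p.xdB'' + CΦ + p.k₁ * χ + χ + p.α₁ * (χ + p.α₁ * χ) with hCu
  have key : ∀ t ∈ span p.t₀ b,
      ‖s.e p t‖ ≤ χ ∧ ‖s.r p t‖ ≤ χ ∧ ‖s.θt p t‖ ≤ χ ∧ ‖s.x t‖ ≤ χ + p.xdB ∧ ‖s.v t‖ ≤ Cv ∧
      ‖s.θh t‖ ≤ Cθ ∧ ‖s.u p t‖ ≤ Cu ∧ ‖s.z p t‖ ≤ Cz ∧ ‖s.rh t‖ ≤ χ + Cz ∧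
      ‖s.Δh t‖ ≤ Cf + Cu + Cz ∧ ‖s.Γ t‖ ≤ p.lΓmax ∧ ‖s.Γinv t‖ ≤ 1 / p.lΓmin := by
    intro t ht
    have hζ : ‖s.ζ p t‖ ≤ χ := hD t ht
    obtain ⟨hr, he, hw⟩ := Arch.norm_le_norm_err (s.r p t) (s.e p t) (s.θt p t)
    replace hr : ‖s.r p t‖ ≤ χ := hr.trans hζ
    replace he : ‖s.e p t‖ ≤ χ := he.trans hζ
    have hX : s.X t ∈ Metric.closedBall (0 : A.Inp) RX := by
      rw [mem_closedBall_zero_iff]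
      exact s.X_mem_Ω p ht.1 (hD t ht)
    have hθ := h.θh_mem ht
    have hed : ‖s.edot p t‖ ≤ χ + p.α₁ * χ := by
      have e1 : s.edot p t = s.r p t - p.α₁ • s.e p t := by simp [Signals.r]
      rw [e1]
      refine (norm_sub_le _ _).trans (add_le_add hr ?_)
      rw [norm_smul, Real.norm_of_nonneg hα.le]
      gcongr
    have hu : ‖s.u p t‖ ≤ Cu := by
      unfold Signals.u
      refine (norm_sub_le _ _).trans (add_le_add ((norm_sub_le _ _).trans (add_le_add
        ((norm_sub_le _ _).trans (add_le_add ((norm_sub_le _ _).trans (add_le_add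
          (p.xd''_le t ht.1) (hCΦ (s.X t, s.θh t) ⟨hX, hθ⟩))) ?_)) he)) ?_)
      · rw [norm_smul, Real.norm_of_nonneg hk.le]
        gcongr
      · rw [norm_smul, Real.norm_of_nonneg hα.le]
        gcongr
    have hz : ‖s.z p t‖ ≤ Cz :=
      Real.le_sqrt_of_sq_le (h.norm_sq_z_le_const hf ht fun τ hτ => hD τ (Icc_subset_span ht hτ))
    have hzz := norm_sq_z s p t
    have hrt : ‖s.rt p t‖ ≤ Cz :=
      (abs_le_of_sq_le_sq' (by nlinarith [sq_nonneg ‖s.Δt p t‖]) (norm_nonneg _)).2.trans hz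
    have hΔt : ‖s.Δt p t‖ ≤ Cz :=
      (abs_le_of_sq_le_sq' (by nlinarith [sq_nonneg ‖s.rt p t‖]) (norm_nonneg _)).2.trans hz
    refine ⟨he, hr, hw.trans hζ, ?_, ?_, hCθ _ hθ, hu, hz, ?_, ?_, h.norm_Γ_le ht,
      h.norm_Γinv_le ht⟩
    · have e1 : s.x t = s.e p t + p.xd t := by simp [Signals.e]
      rw [e1]
      exact (norm_add_le _ _).trans (add_le_add he (p.xd_le t ht.1))
    · have e1 : s.v t = s.edot p t + deriv p.xd t := by simp [Signals.edot]
      rw [e1]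
      exact (norm_add_le _ _).trans (add_le_add hed (p.xd'_le t ht.1))
    · have e1 : s.rh t = s.r p t - s.rt p t := by simp [Signals.rt]
      rw [e1]
      exact (norm_sub_le _ _).trans (add_le_add hr hrt)
    · have e1 : s.Δh t = p.f (s.X t) + s.u p t - s.Δt p t := by
        simp [Signals.Δt, Signals.acc]
      rw [e1]
      exact (norm_sub_le _ _).trans
        (add_le_add ((norm_add_le _ _).trans (add_le_add (hCf _ hX) hu)) hΔt)
  refine ⟨χ + (χ + p.xdB) + Cv + Cθ + Cu + Cz + (χ + Cz) + (Cf + Cu + Cz) + p.lΓmax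
    + 1 / p.lΓmin, fun t ht => ?_⟩
  obtain ⟨h1, h2, h3, h4, h5, h6, h7, h8, h9, h10, h11, h12⟩ := key t ht
  have n1 := (norm_nonneg _).trans h1
  have n4 := (norm_nonneg _).trans h4
  have n5 := (norm_nonneg _).trans h5
  have n6 := (norm_nonneg _).trans h6
  have n7 := (norm_nonneg _).trans h7
  have n8 := (norm_nonneg _).trans h8
  have n9 := (norm_nonneg _).trans h9
  have n10 := (norm_nonneg _).trans h10
  have n11 := p.lΓmax_pos
  have n12 := one_div_pos.2 p.lΓmin_pos
  refine ⟨?_, ?_, ?_, ?_, ?_, ?_, ?_, ?_, ?_, ?_, ?_, ?_⟩ <;> linarith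

end IsClosedLoop

end CLDNN

/-- The bounding functions and the bound on `d/dt f` exist, and for every choice of them every
solution of the closed loop with the second concurrent-learning law satisfies the exponential
envelope from the time `T` on from which the history stack has excitation level `lam_e`
(`T = t₀` and `lam_e = 0` are allowed), and all its signals are bounded. -/
theorem mainTheorem2 {A : CLDNN.Arch} (p : CLDNN.Problem A) :
    (∃ ρ₁ ρ₂ ρ₃ ρ₅ : ℝ → ℝ, p.IsBounding ρ₁ ρ₂ ρ₃ ρ₅) ∧
    (∀ χ : ℝ, ∃ δf : ℝ, 0 < δf ∧ p.IsFdotBound χ δf) ∧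
    ∀ (N : ℕ) (s : CLDNN.Signals A N) (b : EReal)
      (ρ₁ ρ₂ ρ₃ ρ₅ ρδ : ℝ → ℝ) (σ δf εB lam_e T lam₃d χ₄ : ℝ),
      -- bounding functions, and the radius `χ₄ = ρδ⁻¹(λ₃ - λ₃d)`
      p.IsBounding ρ₁ ρ₂ ρ₃ ρ₅ →
      CLDNN.Problem.IncrNonneg ρδ →
      (∀ a : ℝ, 0 ≤ a → 1 / 2 * ρ₂ a ^ 2 * a ^ 2
        + p.γ₁ / 2 * ∑ i, ρ₃ ‖s.ζ p (s.ts i)‖ ^ 2 * a ^ 2 ≤ ρδ a) →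
      0 ≤ χ₄ → ρδ χ₄ = p.lam₃ N lam_e - lam₃d →
      -- ideal weights and approximation error on `Ω`
      0 < σ → IsMinOn (p.loss σ (p.Ω χ₄)) p.Θ p.θs →
      (∀ X ∈ p.Ω χ₄, ‖p.appErr X‖ ≤ εB) →
      -- gain conditions
      0 < δf → p.IsFdotBound χ₄ δf →
      δf ^ 2 / p.δΔ ^ 2 < p.kΔ * p.Λ₁ →
      0 < lam₃d →
      -- closed loop, excitation from time `T` on, initial condition
      CLDNN.IsClosedLoop p s b δf →
      0 ≤ lam_e → T ∈ CLDNN.span p.t₀ b →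
      (∀ t ∈ CLDNN.span p.t₀ b, T ≤ t → lam_e ≤ CLDNN.lamMin (s.gram p t)) →
      (∀ t, p.t₀ ≤ t → t < T → s.ζ p t ∈ p.D χ₄) →
      s.ζ p T ∈ s.H p ρ₁ ρ₅ εB χ₄ lam₃d →
      -- exponential envelope
      (∀ t ∈ CLDNN.span p.t₀ b, T ≤ t →
        ‖s.ζ p t‖ ≤ √(p.β₂ / p.β₁ * ‖s.ζ p T‖ ^ 2 * Real.exp (-(lam₃d / p.β₂) * (t - T))
          + p.β₂ * s.ι₄ p ρ₁ ρ₅ εB / (p.β₁ * lam₃d)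
            * (1 - Real.exp (-(lam₃d / p.β₂) * (t - T))))) ∧
      -- invariance
      (∀ t ∈ CLDNN.span p.t₀ b,
        s.ζ p t ∈ p.D χ₄ ∧ s.X t ∈ p.Ω χ₄ ∧ s.θh t ∈ p.Θε) ∧
      -- boundedness of all signals
      ∃ C : ℝ, ∀ t ∈ CLDNN.span p.t₀ b,
        ‖s.e p t‖ ≤ C ∧ ‖s.r p t‖ ≤ C ∧ ‖s.θt p t‖ ≤ C ∧ ‖s.x t‖ ≤ C ∧ ‖s.v t‖ ≤ C ∧
        ‖s.θh t‖ ≤ C ∧ ‖s.u p t‖ ≤ C ∧ ‖s.z p t‖ ≤ C ∧ ‖s.rh t‖ ≤ C ∧ ‖s.Δh t‖ ≤ C ∧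
        ‖s.Γ t‖ ≤ C ∧ ‖s.Γinv t‖ ≤ C := by
  refine ⟨p.exists_isBounding, p.exists_isFdotBound, ?_⟩
  intro N s b ρ₁ ρ₂ ρ₃ ρ₅ ρδ σ δf εB lam_e T lam₃d χ₄ hb hρδ hδ hχ0 hχ _ _ hε _ hf hgain h3d h _
    hT hexc hpre hH
  have hTlt : ‖s.ζ p T‖ < χ₄ := by
    have h1 := CLDNN.Signals.envelope_lt (t := T) h3d le_rfl hH
    have h2 : ‖s.ζ p T‖ ^ 2 ≤ p.β₂ / p.β₁ * ‖s.ζ p T‖ ^ 2 :=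
      le_mul_of_one_le_left (sq_nonneg _) ((one_le_div p.β₁_pos).2 p.β₁_le_β₂)
    simp only [sub_self, mul_zero, Real.exp_zero, mul_one, add_zero] at h1
    exact lt_of_pow_lt_pow_left₀ 2 hχ0 (h2.trans_lt h1)
  -- First-exit argument: c is the first time from T on with ‖ζ‖ ≥ χ₄. By left continuity the closed
  -- ball is not left up to and including c, so the envelope applies at c and gives ‖ζ(c)‖ < χ₄.
  have hball : ∀ t ∈ CLDNN.span p.t₀ b, T ≤ t → ‖s.ζ p t‖ < χ₄ := by
    intro t ht hTt
    by_contra hcon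
    have hcont := (h.continuousOn_norm_ζ ht).mono (Set.Icc_subset_Icc_left hT.1 : Set.Icc T t ⊆ _)
    have hcl : IsClosed (Set.Icc T t ∩ (fun τ => ‖s.ζ p τ‖) ⁻¹' Set.Ici χ₄) :=
      hcont.preimage_isClosed_of_isClosed isClosed_Icc isClosed_Ici
    obtain ⟨c, hc, hmin⟩ := (isCompact_Icc.of_isClosed_subset hcl
      Set.inter_subset_left).exists_isLeast ⟨t, ⟨hTt, le_rfl⟩, not_lt.1 hcon⟩
    have hlt : ∀ τ, T ≤ τ → τ < c → ‖s.ζ p τ‖ < χ₄ := fun τ h1 h2 => by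
      by_contra h3
      exact absurd (hmin ⟨⟨h1, h2.le.trans hc.1.2⟩, not_lt.1 h3⟩) (not_le.2 h2)
    have hTc : T < c := lt_of_le_of_ne hc.1.1 fun heq => not_lt.2 hc.2 (heq ▸ hTlt)
    have hcs := CLDNN.span_of_le ht (hT.1.trans hc.1.1) hc.1.2
    have hcle : ‖s.ζ p c‖ ≤ χ₄ := by
      have hcc : ContinuousWithinAt (fun τ => ‖s.ζ p τ‖) (Set.Ico T c) c :=
        (hcont c hc.1).mono fun τ hτ => ⟨hτ.1, hτ.2.le.trans hc.1.2⟩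
      have hcl' : c ∈ closure (Set.Ico T c) := by
        rw [closure_Ico hTc.ne]
        exact Set.right_mem_Icc.2 hTc.le
      have : (nhdsWithin c (Set.Ico T c)).NeBot := mem_closure_iff_nhdsWithin_neBot.1 hcl'
      refine le_of_tendsto hcc ?_
      filter_upwards [self_mem_nhdsWithin] with τ hτ using (hlt τ hτ.1 hτ.2).le
    have hD : ∀ τ ∈ Set.Icc p.t₀ c, s.ζ p τ ∈ p.D χ₄ := fun τ hτ => by
      rcases lt_or_ge τ T with h1 | h1
      · exact hpre τ hτ.1 h1
      · rcases hτ.2.eq_or_lt with h2 | h2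
        · exact h2 ▸ hcle
        · exact (hlt τ h1 h2).le
    have h1 := h.norm_sq_ζ_le hb hρδ hδ hχ hε hf hgain h3d hT.1 hTc.le hcs hexc hD
    have h2 := h1.trans_lt (CLDNN.Signals.envelope_lt h3d hTc.le hH)
    exact not_lt.2 hc.2 (lt_of_pow_lt_pow_left₀ 2 hχ0 h2)
  have hD : ∀ t ∈ CLDNN.span p.t₀ b, s.ζ p t ∈ p.D χ₄ := fun t ht => by
    rcases lt_or_ge t T with h1 | h1
    · exact hpre t ht.1 h1
    · exact (hball t ht h1).le
  refine ⟨fun t ht hTt => Real.le_sqrt_of_sq_le ?_,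
    fun t ht => ⟨hD t ht, s.X_mem_Ω p ht.1 (hD t ht), h.θh_mem ht⟩, h.exists_bound hf hD⟩
  exact h.norm_sq_ζ_le hb hρδ hδ hχ hε hf hgain h3d hT.1 hTt ht hexc
    fun τ hτ => hD τ (CLDNN.Icc_subset_span ht hτ)
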